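/- **Proposition 4.2.** Let $M$ be an $n$-dimensional $C^\infty$ manifold, $L$ a Finsler metric function on $TM$ (positive and $C^\infty$ on nonzero vectors, positively homogeneous of degree one, with positive definite fundamental tensor), $\sigma$ a smooth function and $\beta=b_i(x)y^i$ a smooth $1$-form on $M$, such that $\overline L(x,y)=e^{\sigma(x)}L(x,y)+\beta(x,y)$ is again a Finsler metric function. In any local coordinates, with $\partial_i=\partial/\partial x^i$, $\dot\partial_i=\partial/\partial y^i$, put $g_{ij}=\tfrac12\dot\partial_i\dot\partial_jL^2$, $L_i=\dot\partial_iL$, $L_{ij}=\dot\partial_jL_i$, $L_{ijk}=\dot\partial_kL_{ij}$, $\overline L_i=\dot\partial_i\overline L$, $h_{ij}=LL_{ij}$, $C_{ijk}=\tfrac12\dot\partial_kg_{ij}$, $C^k_{ij}=g^{kl}C_{lij}$. Let $\Gamma^i_{jk}$ and $\overline\Gamma{}^i_{jk}$ be the coefficients of the Cartan connections of $L$ and $\overline L$, let $D^i_{jk}=\overline\Gamma{}^i_{jk}-\Gamma^i_{jk}$ be the difference tensor, and let $X_{i|j}$ denote the horizontal covariant derivative of a covector $X_i$ with respect to $\Gamma$.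 An index $0$ denotes contraction with $y$ in that slot, e.g. $F_{i0}=F_{ij}y^j$, $D^r_{0j}=D^r_{kj}y^k$. Put $b^i=g^{ij}b_j$, $\sigma_i=\partial_i\sigma$, $\sigma^r=g^{ri}\sigma_i$, $\sigma_0=\sigma_iy^i$, $\sigma_\beta=\sigma_ib^i$, $\mu_{ij}=\sigma_iL_j-\sigma_jL_i$, $$E_{ij}=\tfrac12(b_{i|j}+b_{j|i}),\qquad F_{ij}=\tfrac12(b_{i|j}-b_{j|i}),\qquad F_{\beta0}=F_{i0}b^i,$$ and let $G_{ij}$ be the tensor given by the two equal expressions $$G_{ij}:=e^{-\sigma}F_{ij}-\tfrac12L_{ijr}D^r_{00}+\tfrac12(\sigma_0L_{ij}-\mu_{ij})=L_{ir}D^r_{0j}.$$ Then, at every $(x,y)$ with $y\neq0$, the tensor $G_{ij}$ can be written without the difference tensor: $$G_{ij}=e^{-\sigma}F_{ij}+\frac{e^{-\sigma}}{L}(L_iF_{j0}+L_jF_{i0})-2e^{-\sigma}C^k_{ij}F_{k0}+G\,h_{ij}+\frac12\Big[L^2L_{ijr}\sigma^r+\frac{L^2}{\overline L}L_{ij}\sigma_\beta+(\sigma_0L_{ij}-\mu_{ij})\Big]+\frac{L}{\overline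 L}e^{\sigma}\sigma_0L_{ij},$$ where $G=\dfrac{1}{2L\overline L}\big(E_{00}-2Le^{-\sigma}F_{\beta0}\big)$. In particular, in the Randers case ($\sigma=0$ and $L$ the norm of a Riemannian metric) one recovers Matsumoto's tensor $$G_{ij}=F_{ij}+\frac1L(L_iF_{j0}+L_jF_{i0})+K\,h_{ij},\qquad K=\frac{1}{2L\overline L}(E_{00}-2LF_{\beta0}),$$ and the covector $G_i:=E_{0i}-\tfrac12e^{\sigma}L_{ir}D^r_{00}+\tfrac12e^{\sigma}(\sigma_0L_i+\sigma_iL)=\overline L_rD^r_{0i}$ is then $G_i=E_{0i}-F_{i0}$. -/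

import Mathlib

open scoped Manifold ContDiff

namespace FinslerGeometry

noncomputable section

/-- Coordinate `n`-space; also the model space of the manifolds below. -/
abbrev Vec (n : ℕ) : Type := EuclideanSpace ℝ (Fin n)

/-! ### Local Finsler geometry

A function on a coordinate piece of the tangent bundle is written `f x y`, where `x` is the position
and `y` the supporting element. -/

section Coordinates

variable {n : ℕ}

/-- Partial differentiation with respect to `x^i`. -/
def pdx (i : Fin n) (f : Vec n → Vec n → ℝ) (x y : Vec n) : ℝ :=
  fderiv ℝ (fun x' => f x' y) x (EuclideanSpace.single i 1)

/-- Partial differentiation with respect to `y^i`. -/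
def pdy (i : Fin n) (f : Vec n → Vec n → ℝ) (x y : Vec n) : ℝ :=
  fderiv ℝ (fun y' => f x y') y (EuclideanSpace.single i 1)

/-- The energy `E = L² / 2`. -/
def energy (L : Vec n → Vec n → ℝ) (x y : Vec n) : ℝ := L x y ^ 2 / 2

/-- The fundamental metric tensor `g_ij`, the `y`-Hessian of the energy. -/
def metric (L : Vec n → Vec n → ℝ) (i j : Fin n) (x y : Vec n) : ℝ :=
  pdy i (pdy j (energy L)) x y

/-- The matrix `(g_ij)`. -/
def metricMatrix (L : Vec n → Vec n → ℝ) (x y : Vec n) : Matrix (Fin n) (Fin n) ℝ :=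
  Matrix.of fun i j => metric L i j x y

/-- The inverse matrix `g^ij`. -/
def invMetric (L : Vec n → Vec n → ℝ) (i j : Fin n) (x y : Vec n) : ℝ :=
  (metricMatrix L x y)⁻¹ i j

/-- `L_i`, the normalized supporting element. -/
def L1 (L : Vec n → Vec n → ℝ) (i : Fin n) : Vec n → Vec n → ℝ := pdy i L

/-- `L_ij`, the derivative of `L_i` with respect to `y^j`. -/
def L2 (L : Vec n → Vec n → ℝ) (i j : Fin n) : Vec n → Vec n → ℝ := pdy j (L1 L i)

/-- `L_ijk`, the derivative of `L_ij` with respect to `y^k`. -/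
def L3 (L : Vec n → Vec n → ℝ) (i j k : Fin n) : Vec n → Vec n → ℝ := pdy k (L2 L i j)

/-- The angular metric tensor `h_ij = L L_ij`. -/
def angular (L : Vec n → Vec n → ℝ) (i j : Fin n) (x y : Vec n) : ℝ := L x y * L2 L i j x y

/-- The Cartan tensor `C_ijk`, half of the derivative of `g_ij` with respect to `y^k`. -/
def cartanTensor (L : Vec n → Vec n → ℝ) (i j k : Fin n) (x y : Vec n) : ℝ :=
  pdy k (metric L i j) x y / 2

/-- The torsion tensor `C^i_jk = g^il C_ljk`. -/
def cartanUp (L : Vec n → Vec n → ℝ) (i j k : Fin n) (x y : Vec n) : ℝ :=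
  ∑ l, invMetric L i l x y * cartanTensor L l j k x y

/-- The formal Christoffel symbols
`γ^i_jk = (1/2) g^ih (∂_k g_hj + ∂_j g_hk - ∂_h g_jk)`. -/
def christoffel (L : Vec n → Vec n → ℝ) (i j k : Fin n) (x y : Vec n) : ℝ :=
  (1 / 2) * ∑ h, invMetric L i h x y *
    (pdx k (metric L h j) x y + pdx j (metric L h k) x y - pdx h (metric L j k) x y)

/-- The coefficients of the canonical (Cartan) nonlinear connection,
`N^i_j = γ^i_jk y^k - C^i_jk γ^k_rs y^r y^s`.
These are also `y^k Γ^i_jk`, where `Γ` is `cartanConn` below. -/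
def nonlinConn (L : Vec n → Vec n → ℝ) (i j : Fin n) (x y : Vec n) : ℝ :=
  (∑ k, christoffel L i j k x y * y k) -
    ∑ k, cartanUp L i j k x y * ∑ r, ∑ s, christoffel L k r s x y * y r * y s

/-- The horizontal derivation `δ_k = ∂_k - N^r_k (∂/∂y^r)`. -/
def delta (L : Vec n → Vec n → ℝ) (k : Fin n) (f : Vec n → Vec n → ℝ) (x y : Vec n) : ℝ :=
  pdx k f x y - ∑ r, nonlinConn L r k x y * pdy r f x y

/-- The (horizontal) coefficients of the Cartan connection,
`Γ^i_jk = (1/2) g^ih (δ_k g_hj + δ_j g_hk - δ_h g_jk)`. -/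
def cartanConn (L : Vec n → Vec n → ℝ) (i j k : Fin n) (x y : Vec n) : ℝ :=
  (1 / 2) * ∑ h, invMetric L i h x y *
    (delta L k (metric L h j) x y + delta L j (metric L h k) x y
      - delta L h (metric L j k) x y)

/-- The horizontal covariant derivative `X_{i|j} = δ_j X_i - X_r Γ^r_ij` of a covector field. -/
def hcov (L : Vec n → Vec n → ℝ) (X : Fin n → Vec n → Vec n → ℝ) (i j : Fin n)
    (x y : Vec n) : ℝ :=
  delta L j (X i) x y - ∑ r, X r x y * cartanConn L r i j x y

/-! In the following, `b i` is the component `b_i(x)` of a one-form. -/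

/-- `E_ij = (b_{i|j} + b_{j|i}) / 2`. -/
def symE (L : Vec n → Vec n → ℝ) (b : Fin n → Vec n → ℝ) (i j : Fin n) (x y : Vec n) : ℝ :=
  (hcov L (fun r x' _ => b r x') i j x y + hcov L (fun r x' _ => b r x') j i x y) / 2

/-- `F_ij = (b_{i|j} - b_{j|i}) / 2`. -/
def skewF (L : Vec n → Vec n → ℝ) (b : Fin n → Vec n → ℝ) (i j : Fin n) (x y : Vec n) : ℝ :=
  (hcov L (fun r x' _ => b r x') i j x y - hcov L (fun r x' _ => b r x') j i x y) / 2

/-- `E_0i = E_ji y^j`. -/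
def symE0 (L : Vec n → Vec n → ℝ) (b : Fin n → Vec n → ℝ) (i : Fin n) (x y : Vec n) : ℝ :=
  ∑ j, symE L b j i x y * y j

/-- `E_00 = E_ij y^i y^j`. -/
def symE00 (L : Vec n → Vec n → ℝ) (b : Fin n → Vec n → ℝ) (x y : Vec n) : ℝ :=
  ∑ i, ∑ j, symE L b i j x y * y i * y j

/-- `F_i0 = F_ij y^j` (contraction of the second index). -/
def skewF0 (L : Vec n → Vec n → ℝ) (b : Fin n → Vec n → ℝ) (i : Fin n) (x y : Vec n) : ℝ :=
  ∑ j, skewF L b i j x y * y j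

/-- `b^i = g^ij b_j`. -/
def bUp (L : Vec n → Vec n → ℝ) (b : Fin n → Vec n → ℝ) (i : Fin n) (x y : Vec n) : ℝ :=
  ∑ j, invMetric L i j x y * b j x

/-- `F_β0 = F_i0 b^i`. -/
def skewFβ0 (L : Vec n → Vec n → ℝ) (b : Fin n → Vec n → ℝ) (x y : Vec n) : ℝ :=
  ∑ i, skewF0 L b i x y * bUp L b i x y

/-! In the following, `s` is the coordinate expression of the function `σ(x)`. -/

/-- `σ_i`, the derivative of `σ` with respect to `x^i`. -/
def sig (s : Vec n → ℝ) (i : Fin n) (x : Vec n) : ℝ :=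
  fderiv ℝ s x (EuclideanSpace.single i 1)

/-- `σ^i = g^ij σ_j`. -/
def sigUp (L : Vec n → Vec n → ℝ) (s : Vec n → ℝ) (i : Fin n) (x y : Vec n) : ℝ :=
  ∑ j, invMetric L i j x y * sig s j x

/-- `σ_0 = σ_i y^i`. -/
def sig0 (s : Vec n → ℝ) (x y : Vec n) : ℝ := ∑ i, sig s i x * y i

/-- `σ_β = σ_i b^i`. -/
def sigβ (L : Vec n → Vec n → ℝ) (s : Vec n → ℝ) (b : Fin n → Vec n → ℝ) (x y : Vec n) : ℝ :=
  ∑ i, sig s i x * bUp L b i x y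

/-- `μ_ij = σ_i L_j - σ_j L_i`. -/
def muT (L : Vec n → Vec n → ℝ) (s : Vec n → ℝ) (i j : Fin n) (x y : Vec n) : ℝ :=
  sig s i x * L1 L j x y - sig s j x * L1 L i x y

/-! In the following, `Lb` is a second Finsler function on the same coordinate piece. -/

/-- The difference tensor `D^i_jk` of the Cartan connections of `Lb` and `L`. -/
def diffT (L Lb : Vec n → Vec n → ℝ) (i j k : Fin n) (x y : Vec n) : ℝ :=
  cartanConn Lb i j k x y - cartanConn L i j k x y

/-- `D^i_0j = D^i_kj y^k`. -/
def diff0 (L Lb : Vec n → Vec n → ℝ) (i j : Fin n) (x y : Vec n) : ℝ :=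
  ∑ k, diffT L Lb i k j x y * y k

/-- `D^i_00 = D^i_jk y^j y^k`. -/
def diff00 (L Lb : Vec n → Vec n → ℝ) (i : Fin n) (x y : Vec n) : ℝ :=
  ∑ j, ∑ k, diffT L Lb i j k x y * y j * y k

/-- The tensor
`G_ij = e^{-σ} F_ij - (1/2) L_ijr D^r_00 + (1/2) (σ_0 L_ij - μ_ij)`. -/
def tensorG (L Lb : Vec n → Vec n → ℝ) (s : Vec n → ℝ) (b : Fin n → Vec n → ℝ)
    (i j : Fin n) (x y : Vec n) : ℝ :=
  Real.exp (-s x) * skewF L b i j x y - (1 / 2) * ∑ r, L3 L i j r x y * diff00 L Lb r x y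
    + (1 / 2) * (sig0 s x y * L2 L i j x y - muT L s i j x y)

/-- The covector
`G_i = E_0i - (1/2) e^σ L_ir D^r_00 + (1/2) e^σ (σ_0 L_i + σ_i L)`. -/
def covectorG (L Lb : Vec n → Vec n → ℝ) (s : Vec n → ℝ) (b : Fin n → Vec n → ℝ)
    (i : Fin n) (x y : Vec n) : ℝ :=
  symE0 L b i x y - (1 / 2) * Real.exp (s x) * ∑ r, L2 L i r x y * diff00 L Lb r x y
    + (1 / 2) * Real.exp (s x) * (sig0 s x y * L1 L i x y + sig s i x * L x y)

end Coordinates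

/-! ### Finsler manifolds -/

section Manifolds

variable {n : ℕ} {M : Type*} [TopologicalSpace M] [ChartedSpace (EuclideanSpace ℝ (Fin n)) M]

/-- The coordinate expression `L(x, y)`, in the chart `e`, of a function on the tangent bundle:
its value at the tangent vector `y^i ∂/∂x^i` at the point with coordinates `x`. -/
def localRep (e : OpenPartialHomeomorph M (EuclideanSpace ℝ (Fin n)))
    (L : ∀ p : M, TangentSpace (𝓡 n) p → ℝ) (x y : Vec n) : ℝ :=
  L (e.symm x) (mfderiv (𝓡 n) (𝓡 n) e.symm x y)

/-- The component `b_i(x)`, in the chart `e`, of a one-form. -/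
def oneFormComp (e : OpenPartialHomeomorph M (EuclideanSpace ℝ (Fin n)))
    (β : ∀ p : M, TangentSpace (𝓡 n) p →L[ℝ] ℝ) (i : Fin n) (x : Vec n) : ℝ :=
  β (e.symm x) (mfderiv (𝓡 n) (𝓡 n) e.symm x (EuclideanSpace.single i (1 : ℝ)))

/-- A one-form is smooth if its components in all coordinate systems of `M` are smooth. -/
def IsSmoothOneForm (β : ∀ p : M, TangentSpace (𝓡 n) p →L[ℝ] ℝ) : Prop :=
  ∀ e ∈ IsManifold.maximalAtlas (𝓡 n) ∞ M, ∀ i, ContDiffOn ℝ ∞ (oneFormComp e β i) e.target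

/-- `L` is a Finsler metric function on `M`: it is positive on nonzero vectors, positively
homogeneous of degree one, and in all coordinate systems of `M` it is smooth on the slit tangent
bundle and has a positive definite fundamental tensor there. -/
structure IsFinsler (L : ∀ p : M, TangentSpace (𝓡 n) p → ℝ) : Prop where
  pos : ∀ (p : M) (v : TangentSpace (𝓡 n) p), v ≠ 0 → 0 < L p v
  homogeneous : ∀ (p : M) (c : ℝ) (v : TangentSpace (𝓡 n) p), 0 < c → L p (c • v) = c * L p v
  smooth : ∀ e ∈ IsManifold.maximalAtlas (𝓡 n) ∞ M,
    ContDiffOn ℝ ∞ (fun z : Vec n × Vec n => localRep e L z.1 z.2) (e.target ×ˢ {y | y ≠ 0})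
  posDef : ∀ e ∈ IsManifold.maximalAtlas (𝓡 n) ∞ M, ∀ x ∈ e.target, ∀ y : Vec n, y ≠ 0 →
    (metricMatrix (localRep e L) x y).PosDef

/-- `L` is the norm of a smooth Riemannian metric on `M`. -/
def IsRiemannian [IsManifold (𝓡 n) ∞ M] (L : ∀ p : M, TangentSpace (𝓡 n) p → ℝ) : Prop :=
  ∃ a : Bundle.ContMDiffRiemannianMetric (𝓡 n) ∞ (EuclideanSpace ℝ (Fin n))
      (fun p : M => TangentSpace (𝓡 n) p),
    ∀ (p : M) (v : TangentSpace (𝓡 n) p), L p v = Real.sqrt (a.inner p v v)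

/-- The `β`-conformal change `(x, y) ↦ e^{σ(x)} L(x, y) + β(x, y)` of `L`. -/
def betaConformal (σ : M → ℝ) (β : ∀ p : M, TangentSpace (𝓡 n) p →L[ℝ] ℝ)
    (L : ∀ p : M, TangentSpace (𝓡 n) p → ℝ) : ∀ p : M, TangentSpace (𝓡 n) p → ℝ :=
  fun p v => Real.exp (σ p) * L p v + β p v

end Manifolds

end

end FinslerGeometry

open FinslerGeometry

/-! The Cartan connection of a Finsler function is metrical, so L, L_i and L_ij are horizontally
parallel (`delta_self`, `delta_L1`, `delta_L2`). Let L' = e^σ L + β; then L'_i = e^σ L_i + b_i and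
L'_ij = e^σ L_ij, while the horizontal derivations of L' and L differ only by D^r_0k ∂/∂y^r
(`delta_eq_sub`). Parallelism for L', rewritten with Γ and D, becomes σ_k L_ij = L_ijr D^r_0k + L_jr
D^r_ik + L_ir D^r_jk (`sig_mul_L2`), b_{i|k} + e^σ σ_k L_i = e^σ L_ir D^r_0k + L'_r D^r_ik
(`hcov_add`). The first, contracted with y^k, gives the symmetric part of L_ir D^r_0j; the second,
antisymmetrized, gives the skew part. Their sum is G_ij.

Further contractions with y give L_ir D^r_00 and L'_r D^r_00 free of D. Since g_ir = L_i L_r + L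
L_ir is invertible, the former fixes D^r_00 up to a multiple of y^r (`diff00_eq`) and the latter
fixes the multiple (`component_diff00`). This is inserted into L_ijr D^r_00, using L_ijr y^r = -L_ij
and `sum_L3_mul_skewF0Up`, where the Cartan tensor appears. In the Randers case σ = 0, and the
energy is quadratic on fibres, so the Cartan tensor vanishes. -/

namespace FinslerGeometry

open TopologicalSpace

/-! ### Differential calculus away from the zero section. -/

section LocalTheory

variable {n : ℕ} {U : Opens (Vec n)} {l lb f g : Vec n → Vec n → ℝ} {s : Vec n → ℝ}
  {b : Fin n → Vec n → ℝ} {x y : Vec n}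

/-- Smoothness of a function of position and supporting element, away from the zero section. -/
def SlitSmooth (U : Opens (Vec n)) (f : Vec n → Vec n → ℝ) : Prop :=
  ContDiffOn ℝ ∞ (fun z : Vec n × Vec n => f z.1 z.2) ((U : Set (Vec n)) ×ˢ {y | y ≠ 0})

theorem isOpen_slit (U : Opens (Vec n)) :
    IsOpen ((U : Set (Vec n)) ×ˢ {y : Vec n | y ≠ 0}) :=
  U.isOpen.prod isOpen_ne

theorem SlitSmooth.contDiffAt (hf : SlitSmooth U f) (hx : x ∈ U) (hy : y ≠ 0) :
    ContDiffAt ℝ ∞ (fun z : Vec n × Vec n => f z.1 z.2) (x, y) :=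
  ContDiffOn.contDiffAt hf ((isOpen_slit U).mem_nhds ⟨hx, hy⟩)

theorem SlitSmooth.differentiableAt (hf : SlitSmooth U f) (hx : x ∈ U) (hy : y ≠ 0) :
    DifferentiableAt ℝ (fun z : Vec n × Vec n => f z.1 z.2) (x, y) :=
  (hf.contDiffAt hx hy).differentiableAt (by simp)

theorem SlitSmooth.differentiableAt_left (hf : SlitSmooth U f) (hx : x ∈ U) (hy : y ≠ 0) :
    DifferentiableAt ℝ (fun x' => f x' y) x :=
  (hf.differentiableAt hx hy).comp x (f := fun x' : Vec n => (x', y)) (by fun_prop)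

theorem SlitSmooth.differentiableAt_right (hf : SlitSmooth U f) (hx : x ∈ U) (hy : y ≠ 0) :
    DifferentiableAt ℝ (fun y' => f x y') y :=
  (hf.differentiableAt hx hy).comp y (f := fun y' : Vec n => (x, y')) (by fun_prop)

theorem pdy_eq_fderiv (hf : SlitSmooth U f) (hx : x ∈ U) (hy : y ≠ 0) (i : Fin n) :
    pdy i f x y = fderiv ℝ (fun z : Vec n × Vec n => f z.1 z.2) (x, y)
      (0, EuclideanSpace.single i 1) := by
  have h := (hf.differentiableAt hx hy).hasFDerivAt.comp y
    ((hasFDerivAt_const x y).prodMk (hasFDerivAt_id y))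
  unfold pdy
  rw [show (fun y' => f x y') = (fun z : Vec n × Vec n => f z.1 z.2) ∘ fun y' => (x, y') from rfl,
    HasFDerivAt.fderiv h]
  simp

theorem SlitSmooth.congr (hf : SlitSmooth U f)
    (h : ∀ x ∈ U, ∀ y, y ≠ 0 → g x y = f x y) : SlitSmooth U g :=
  ContDiffOn.congr hf fun z hz => h z.1 hz.1 z.2 hz.2

theorem SlitSmooth.fderiv_apply (hf : SlitSmooth U f) (v : Vec n × Vec n) :
    SlitSmooth U fun x y => fderiv ℝ (fun z : Vec n × Vec n => f z.1 z.2) (x, y) v := by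
  have := ContDiffOn.fderiv_of_isOpen hf (isOpen_slit U) (m := ∞) (by simp)
  exact this.clm_apply contDiffOn_const

theorem SlitSmooth.pdy (hf : SlitSmooth U f) (i : Fin n) : SlitSmooth U (pdy i f) :=
  (hf.fderiv_apply _).congr fun _ hx _ hy => pdy_eq_fderiv hf hx hy i

theorem SlitSmooth.mul (hf : SlitSmooth U f) (hg : SlitSmooth U g) :
    SlitSmooth U fun x y => f x y * g x y := ContDiffOn.mul hf hg

theorem SlitSmooth.sum {F : Fin n → Vec n → Vec n → ℝ} (hF : ∀ i, SlitSmooth U (F i)) :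
    SlitSmooth U fun x y => ∑ i, F i x y := ContDiffOn.sum fun i _ => hF i

theorem slitSmooth_const (c : ℝ) : SlitSmooth U fun _ _ => c := contDiffOn_const

theorem slitSmooth_coord (i : Fin n) : SlitSmooth U fun _ y => y i := by
  unfold SlitSmooth; fun_prop

theorem slitSmooth_position {u : Vec n → ℝ} (hu : ContDiffOn ℝ ∞ u U) :
    SlitSmooth U fun x _ => u x :=
  hu.comp contDiffOn_fst fun _ hz => hz.1

/-- The functions are total, but their identities hold only over `U` with `y ≠ 0`. That set is open,
so the identities can still be differentiated. -/
theorem pdx_congr (h : ∀ x ∈ U, ∀ y, y ≠ 0 → f x y = g x y) (hx : x ∈ U) (hy : y ≠ 0)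
    (i : Fin n) : pdx i f x y = pdx i g x y := by
  have : (fun x' => f x' y) =ᶠ[nhds x] fun x' => g x' y := by
    filter_upwards [U.isOpen.mem_nhds hx] with x' hx' using h x' hx' y hy
  unfold pdx; rw [this.fderiv_eq]

theorem pdy_congr (h : ∀ x ∈ U, ∀ y, y ≠ 0 → f x y = g x y) (hx : x ∈ U) (hy : y ≠ 0)
    (i : Fin n) : pdy i f x y = pdy i g x y := by
  have : (fun y' => f x y') =ᶠ[nhds y] fun y' => g x y' := by
    filter_upwards [isOpen_ne.mem_nhds hy] with y' hy' using h x hx y' hy'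
  unfold pdy; rw [this.fderiv_eq]

theorem pdx_add (hf : SlitSmooth U f) (hg : SlitSmooth U g) (hx : x ∈ U) (hy : y ≠ 0)
    (i : Fin n) : pdx i (fun x y => f x y + g x y) x y = pdx i f x y + pdx i g x y := by
  unfold pdx
  rw [fderiv_fun_add (hf.differentiableAt_left hx hy) (hg.differentiableAt_left hx hy)]; rfl

theorem pdy_add (hf : SlitSmooth U f) (hg : SlitSmooth U g) (hx : x ∈ U) (hy : y ≠ 0)
    (i : Fin n) : pdy i (fun x y => f x y + g x y) x y = pdy i f x y + pdy i g x y := by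
  unfold pdy
  rw [fderiv_fun_add (hf.differentiableAt_right hx hy) (hg.differentiableAt_right hx hy)]; rfl

theorem pdx_mul (hf : SlitSmooth U f) (hg : SlitSmooth U g) (hx : x ∈ U) (hy : y ≠ 0)
    (i : Fin n) : pdx i (fun x y => f x y * g x y) x y
      = f x y * pdx i g x y + g x y * pdx i f x y := by
  unfold pdx
  rw [fderiv_fun_mul (hf.differentiableAt_left hx hy) (hg.differentiableAt_left hx hy)]; rfl

theorem pdy_mul (hf : SlitSmooth U f) (hg : SlitSmooth U g) (hx : x ∈ U) (hy : y ≠ 0)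
    (i : Fin n) : pdy i (fun x y => f x y * g x y) x y
      = f x y * pdy i g x y + g x y * pdy i f x y := by
  unfold pdy
  rw [fderiv_fun_mul (hf.differentiableAt_right hx hy) (hg.differentiableAt_right hx hy)]; rfl

theorem pdx_sum {F : Fin n → Vec n → Vec n → ℝ} (hF : ∀ i, SlitSmooth U (F i)) (hx : x ∈ U)
    (hy : y ≠ 0) (i : Fin n) : pdx i (fun x y => ∑ j, F j x y) x y = ∑ j, pdx i (F j) x y := by
  unfold pdx
  rw [fderiv_fun_sum fun j _ => (hF j).differentiableAt_left hx hy]; simp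

theorem pdy_sum {F : Fin n → Vec n → Vec n → ℝ} (hF : ∀ i, SlitSmooth U (F i)) (hx : x ∈ U)
    (hy : y ≠ 0) (i : Fin n) : pdy i (fun x y => ∑ j, F j x y) x y = ∑ j, pdy i (F j) x y := by
  unfold pdy
  rw [fderiv_fun_sum fun j _ => (hF j).differentiableAt_right hx hy]; simp

theorem pdx_coord (i j : Fin n) (x y : Vec n) : pdx i (fun _ y => y j) x y = 0 := by
  simp [pdx]

theorem pdy_coord (i j : Fin n) (x y : Vec n) :
    pdy i (fun _ y => y j) x y = if j = i then 1 else 0 := by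
  have : HasFDerivAt (fun y : Vec n => y j) (EuclideanSpace.proj j : Vec n →L[ℝ] ℝ) y :=
    (EuclideanSpace.proj j : Vec n →L[ℝ] ℝ).hasFDerivAt
  unfold pdy
  rw [this.fderiv]
  simp

theorem pdy_position (u : Vec n → ℝ) (i : Fin n) (x y : Vec n) :
    pdy i (fun x _ => u x) x y = 0 := by
  simp [pdy]

/-- Both orders are the second Fréchet derivative in (x, y) at vertical vectors, which is symmetric.
-/
theorem pdy_comm (hf : SlitSmooth U f) (hx : x ∈ U) (hy : y ≠ 0) (i j : Fin n) :
    pdy i (pdy j f) x y = pdy j (pdy i f) x y := by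
  have hc := hf.contDiffAt hx hy
  have hd : DifferentiableAt ℝ (fderiv ℝ fun z : Vec n × Vec n => f z.1 z.2) (x, y) :=
    (hc.fderiv_right (m := ∞) (by simp)).differentiableAt (by simp)
  have hs : IsSymmSndFDerivAt ℝ (fun z : Vec n × Vec n => f z.1 z.2) (x, y) :=
    hc.isSymmSndFDerivAt (by simp; exact WithTop.coe_le_coe.2 (le_top : (2 : ℕ∞) ≤ ⊤))
  have key : ∀ i j : Fin n, pdy i (pdy j f) x y =
      fderiv ℝ (fderiv ℝ fun z : Vec n × Vec n => f z.1 z.2) (x, y)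
        (0, EuclideanSpace.single i 1) (0, EuclideanSpace.single j 1) := fun i j => by
    rw [pdy_congr (fun x hx y hy => pdy_eq_fderiv hf hx hy j) hx hy i,
      pdy_eq_fderiv (hf.fderiv_apply _) hx hy i]
    have h := hd.hasFDerivAt.clm_apply
      (hasFDerivAt_const ((0, EuclideanSpace.single j 1) : Vec n × Vec n) (x, y))
    rw [HasFDerivAt.fderiv h]
    simp
  rw [key, key, hs.eq]

/-- The contraction of the `y`-gradient with a vector is a directional derivative. -/
theorem sum_pdy_mul (f : Vec n → Vec n → ℝ) (x y v : Vec n) :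
    ∑ i, pdy i f x y * v i = fderiv ℝ (fun y' => f x y') y v := by
  conv_rhs => rw [← (EuclideanSpace.basisFun (Fin n) ℝ).sum_repr v]
  simp [pdy, mul_comm]

/-- Euler's theorem for positively homogeneous functions of degree one. -/
theorem sum_pdy_mul_self (hf : SlitSmooth U f) (hx : x ∈ U) (hy : y ≠ 0)
    (hom : ∀ c : ℝ, 0 < c → f x (c • y) = c * f x y) : ∑ i, pdy i f x y * y i = f x y := by
  rw [sum_pdy_mul]
  have h1 : HasDerivAt (fun c : ℝ => c • y) y 1 := by
    simpa using (hasDerivAt_id (1 : ℝ)).smul_const y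
  have h2 : HasFDerivAt (fun y' => f x y') (fderiv ℝ (fun y' => f x y') y) ((1 : ℝ) • y) := by
    rw [one_smul]; exact (hf.differentiableAt_right hx hy).hasFDerivAt
  have h3 := h2.comp_hasDerivAt (1 : ℝ) h1
  have h4 : HasDerivAt (fun c : ℝ => c * f x y) (f x y) 1 := by
    simpa using (hasDerivAt_id (1 : ℝ)).mul_const (f x y)
  -- Homogeneity holds only for c > 0, which suffices near c = 1.
  refine h3.unique (h4.congr_of_eventuallyEq ?_)
  filter_upwards [lt_mem_nhds (zero_lt_one (α := ℝ))] with c hc using hom c hc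

/-! ### Algebraic identities from homogeneity and positive definiteness. -/

/-- A Finsler metric function on a coordinate piece of the tangent bundle. -/
structure LocalFinsler (U : Opens (Vec n)) (l : Vec n → Vec n → ℝ) : Prop where
  smooth : SlitSmooth U l
  homogeneous : ∀ x ∈ U, ∀ (y : Vec n) (c : ℝ), 0 < c → l x (c • y) = c * l x y
  posDef : ∀ x ∈ U, ∀ y : Vec n, y ≠ 0 → (metricMatrix l x y).PosDef

namespace LocalFinsler

theorem smooth_L1 (h : LocalFinsler U l) (i : Fin n) : SlitSmooth U (L1 l i) := h.smooth.pdy i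

theorem smooth_L2 (h : LocalFinsler U l) (i j : Fin n) : SlitSmooth U (L2 l i j) :=
  (h.smooth_L1 i).pdy j

theorem smooth_energy (h : LocalFinsler U l) : SlitSmooth U (energy l) :=
  ((h.smooth.mul h.smooth).mul (slitSmooth_const (1 / 2))).congr fun x _ y _ => by
    unfold energy; ring

theorem smooth_metric (h : LocalFinsler U l) (i j : Fin n) : SlitSmooth U (metric l i j) :=
  (h.smooth_energy.pdy j).pdy i

theorem sum_L1_mul (h : LocalFinsler U l) (hx : x ∈ U) (hy : y ≠ 0) :
    ∑ i, L1 l i x y * y i = l x y :=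
  sum_pdy_mul_self h.smooth hx hy fun c hc => h.homogeneous x hx y c hc

theorem L2_symm (h : LocalFinsler U l) (hx : x ∈ U) (hy : y ≠ 0) (i j : Fin n) :
    L2 l i j x y = L2 l j i x y := pdy_comm h.smooth hx hy j i

theorem L3_symm (h : LocalFinsler U l) (hx : x ∈ U) (hy : y ≠ 0) (i j k : Fin n) :
    L3 l i j k x y = L3 l j i k x y :=
  pdy_congr (fun _ hx _ hy => h.L2_symm hx hy i j) hx hy k

theorem L3_symm' (h : LocalFinsler U l) (hx : x ∈ U) (hy : y ≠ 0) (i j k : Fin n) :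
    L3 l i j k x y = L3 l i k j x y := pdy_comm (h.smooth_L1 i) hx hy k j

theorem pdy_sum_mul_coord {F : Fin n → Vec n → Vec n → ℝ} (hF : ∀ i, SlitSmooth U (F i))
    (hx : x ∈ U) (hy : y ≠ 0) (j : Fin n) :
    pdy j (fun x y => ∑ i, F i x y * y i) x y = F j x y + ∑ i, pdy j (F i) x y * y i := by
  rw [pdy_sum (fun i => (hF i).mul (slitSmooth_coord i)) hx hy]
  simp_rw [fun i => pdy_mul (hF i) (slitSmooth_coord i) hx hy j, pdy_coord]
  simp [Finset.sum_add_distrib, mul_comm]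

/-- Differentiate L_i y^i = L in y^j; the term L_j cancels. -/
theorem sum_L2_mul (h : LocalFinsler U l) (hx : x ∈ U) (hy : y ≠ 0) (j : Fin n) :
    ∑ i, L2 l i j x y * y i = 0 := by
  have h1 := pdy_sum_mul_coord h.smooth_L1 hx hy j
  rw [pdy_congr (fun _ hx _ hy => h.sum_L1_mul hx hy) hx hy j] at h1
  have h2 : pdy j l x y = L1 l j x y := rfl
  have h3 : ∑ i, L2 l i j x y * y i = ∑ i, pdy j (L1 l i) x y * y i := rfl
  linarith

theorem sum_L2_mul' (h : LocalFinsler U l) (hx : x ∈ U) (hy : y ≠ 0) (i : Fin n) :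
    ∑ j, L2 l i j x y * y j = 0 := by
  rw [← h.sum_L2_mul hx hy i]
  exact Finset.sum_congr rfl fun j _ => by rw [h.L2_symm hx hy]

/-- Differentiate L_ij y^i = 0 in y^k; differentiating the factor y^i leaves L_kj, hence the sign.
-/
theorem sum_L3_mul (h : LocalFinsler U l) (hx : x ∈ U) (hy : y ≠ 0) (j k : Fin n) :
    ∑ i, L3 l i j k x y * y i = -L2 l j k x y := by
  have h1 := pdy_sum_mul_coord (fun i => h.smooth_L2 i j) hx hy k
  rw [pdy_congr (g := fun _ _ => 0) (fun _ hx _ hy => h.sum_L2_mul hx hy j) hx hy k,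
    pdy_position (fun _ => 0)] at h1
  have h3 : ∑ i, L3 l i j k x y * y i = ∑ i, pdy k (L2 l i j) x y * y i := rfl
  have := h.L2_symm hx hy j k
  linarith

theorem sum_L3_mul₂ (h : LocalFinsler U l) (hx : x ∈ U) (hy : y ≠ 0) (i k : Fin n) :
    ∑ j, L3 l i j k x y * y j = -L2 l i k x y := by
  rw [← h.sum_L3_mul hx hy i k]
  exact Finset.sum_congr rfl fun j _ => by rw [h.L3_symm hx hy]

theorem sum_L3_mul₃ (h : LocalFinsler U l) (hx : x ∈ U) (hy : y ≠ 0) (i j : Fin n) :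
    ∑ k, L3 l i j k x y * y k = -L2 l i j x y := by
  rw [← h.sum_L3_mul₂ hx hy i j]
  exact Finset.sum_congr rfl fun k _ => by rw [h.L3_symm' hx hy]

theorem metric_eq (h : LocalFinsler U l) (hx : x ∈ U) (hy : y ≠ 0) (i j : Fin n) :
    metric l i j x y = L1 l i x y * L1 l j x y + l x y * L2 l i j x y := by
  have h1 : ∀ x ∈ U, ∀ y, y ≠ 0 → pdy j (energy l) x y = l x y * L1 l j x y := by
    intro x hx y hy
    have h2 : energy l = fun x y => (1 / 2) * (l x y * l x y) := by
      funext x y; unfold energy; ring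
    rw [h2, pdy_mul (slitSmooth_const _) (h.smooth.mul h.smooth) hx hy,
      pdy_mul h.smooth h.smooth hx hy, pdy_position (fun _ => 1 / 2)]
    change _ = l x y * pdy j l x y
    ring
  unfold metric
  rw [pdy_congr h1 hx hy i, pdy_mul h.smooth (h.smooth_L1 j) hx hy, h.L2_symm hx hy]
  change l x y * L2 l j i x y + L1 l j x y * L1 l i x y = _
  ring

theorem metric_symm (h : LocalFinsler U l) (hx : x ∈ U) (hy : y ≠ 0) (i j : Fin n) :
    metric l i j x y = metric l j i x y := pdy_comm h.smooth_energy hx hy i j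

theorem sum_metric_mul (h : LocalFinsler U l) (hx : x ∈ U) (hy : y ≠ 0) (i : Fin n) :
    ∑ j, metric l i j x y * y j = l x y * L1 l i x y := by
  have : ∀ j, metric l i j x y * y j
      = L1 l i x y * (L1 l j x y * y j) + l x y * (L2 l i j x y * y j) := fun j => by
    rw [h.metric_eq hx hy]; ring
  simp_rw [this, Finset.sum_add_distrib, ← Finset.mul_sum, h.sum_L1_mul hx hy,
    h.sum_L2_mul' hx hy]
  ring

theorem sum_sum_metric_mul (h : LocalFinsler U l) (hx : x ∈ U) (hy : y ≠ 0) :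
    ∑ i, (∑ j, metric l i j x y * y j) * y i = l x y ^ 2 := by
  simp_rw [h.sum_metric_mul hx hy, mul_assoc, ← Finset.mul_sum, h.sum_L1_mul hx hy]
  ring

/-- Positivity is not a field of `LocalFinsler`; g_ij y^i y^j = L² and definiteness replace it. -/
theorem ne_zero (h : LocalFinsler U l) (hx : x ∈ U) (hy : y ≠ 0) : l x y ≠ 0 := by
  intro h0
  have hy' : (fun i => y i : Fin n → ℝ) ≠ 0 := fun hz => hy (by
    ext i; exact congrFun hz i)
  have h1 := (h.posDef x hx y hy).dotProduct_mulVec_pos hy'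
  have h2 := h.sum_sum_metric_mul hx hy
  have h3 : star (fun i => y i : Fin n → ℝ) ⬝ᵥ (metricMatrix l x y).mulVec (fun i => y i)
      = ∑ i, (∑ j, metric l i j x y * y j) * y i := by
    simp [dotProduct, Matrix.mulVec, metricMatrix, mul_comm]
  rw [h3, h2, h0] at h1
  simp at h1

theorem isUnit_det (h : LocalFinsler U l) (hx : x ∈ U) (hy : y ≠ 0) :
    IsUnit (metricMatrix l x y).det := (h.posDef x hx y hy).det_pos.ne'.isUnit

theorem invMetric_symm (h : LocalFinsler U l) (hx : x ∈ U) (hy : y ≠ 0) (i j : Fin n) :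
    invMetric l i j x y = invMetric l j i x y := by
  have h1 : (metricMatrix l x y).transpose = metricMatrix l x y := by
    ext i j; exact h.metric_symm hx hy j i
  have h2 := Matrix.transpose_nonsing_inv (metricMatrix l x y)
  rw [h1] at h2
  exact congrFun (congrFun h2 j) i

theorem sum_metric_invMetric (h : LocalFinsler U l) (hx : x ∈ U) (hy : y ≠ 0) (v : Fin n → ℝ)
    (j : Fin n) : ∑ r, metric l j r x y * ∑ k, invMetric l r k x y * v k = v j := by
  have h1 : (metricMatrix l x y).mulVec ((metricMatrix l x y)⁻¹.mulVec v) = v := by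
    rw [Matrix.mulVec_mulVec, Matrix.mul_nonsing_inv _ (h.isUnit_det hx hy), Matrix.one_mulVec]
  exact congrFun h1 j

/-- Vector identities are proved below by lowering the index, which avoids manipulating g^ij. -/
theorem eq_of_sum_metric (h : LocalFinsler U l) (hx : x ∈ U) (hy : y ≠ 0) {u v : Fin n → ℝ}
    (huv : ∀ j, ∑ r, metric l j r x y * u r = ∑ r, metric l j r x y * v r) : u = v := by
  have h1 : (metricMatrix l x y).mulVec u = (metricMatrix l x y).mulVec v := funext huv
  have h2 := congrArg (metricMatrix l x y)⁻¹.mulVec h1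
  simpa [Matrix.mulVec_mulVec, Matrix.nonsing_inv_mul _ (h.isUnit_det hx hy)] using h2

/-- Differentiate g_ij y^j = L L_i in y^k: g_ik appears on both sides and cancels. -/
theorem sum_pdy_metric_mul (h : LocalFinsler U l) (hx : x ∈ U) (hy : y ≠ 0) (i k : Fin n) :
    ∑ j, pdy k (metric l i j) x y * y j = 0 := by
  have h1 := pdy_sum_mul_coord (fun j => h.smooth_metric i j) hx hy k
  rw [pdy_congr (fun _ hx _ hy => h.sum_metric_mul hx hy i) hx hy k,
    pdy_mul h.smooth (h.smooth_L1 i) hx hy, h.metric_eq hx hy] at h1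
  change l x y * L2 l i k x y + L1 l i x y * L1 l k x y = _ at h1
  linarith

/-- The Cartan tensor in terms of the derivatives of `L`. -/
theorem cartanTensor_eq (h : LocalFinsler U l) (hx : x ∈ U) (hy : y ≠ 0) (i j k : Fin n) :
    2 * cartanTensor l i j k x y = L2 l i k x y * L1 l j x y + L1 l i x y * L2 l j k x y
      + L1 l k x y * L2 l i j x y + l x y * L3 l i j k x y := by
  unfold cartanTensor
  rw [pdy_congr (fun _ hx _ hy => h.metric_eq hx hy i j) hx hy k,
    pdy_add ((h.smooth_L1 i).mul (h.smooth_L1 j)) (h.smooth.mul (h.smooth_L2 i j)) hx hy,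
    pdy_mul (h.smooth_L1 i) (h.smooth_L1 j) hx hy, pdy_mul h.smooth (h.smooth_L2 i j) hx hy]
  change 2 * ((L1 l i x y * L2 l j k x y + L1 l j x y * L2 l i k x y
    + (l x y * L3 l i j k x y + L2 l i j x y * L1 l k x y)) / 2) = _
  ring

theorem cartanTensor_rotate (h : LocalFinsler U l) (hx : x ∈ U) (hy : y ≠ 0) (i j k : Fin n) :
    cartanTensor l i j k x y = cartanTensor l j k i x y := by
  have h1 := h.cartanTensor_eq hx hy i j k
  have h2 := h.cartanTensor_eq hx hy j k i
  rw [h.L3_symm' hx hy j k i, ← h.L3_symm hx hy i j k, h.L2_symm hx hy j i,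
    h.L2_symm hx hy k i] at h2
  linarith

end LocalFinsler

/-! ### The horizontal derivation. -/

section Delta

theorem delta_congr (h : ∀ x ∈ U, ∀ y, y ≠ 0 → f x y = g x y) (hx : x ∈ U) (hy : y ≠ 0)
    (k : Fin n) : delta l k f x y = delta l k g x y := by
  unfold delta
  rw [pdx_congr h hx hy]
  simp_rw [pdy_congr h hx hy]

theorem delta_add (hf : SlitSmooth U f) (hg : SlitSmooth U g) (hx : x ∈ U) (hy : y ≠ 0)
    (k : Fin n) : delta l k (fun x y => f x y + g x y) x y
      = delta l k f x y + delta l k g x y := by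
  unfold delta
  simp_rw [pdx_add hf hg hx hy, pdy_add hf hg hx hy, mul_add, Finset.sum_add_distrib]
  ring

theorem delta_mul (hf : SlitSmooth U f) (hg : SlitSmooth U g) (hx : x ∈ U) (hy : y ≠ 0)
    (k : Fin n) : delta l k (fun x y => f x y * g x y) x y
      = f x y * delta l k g x y + g x y * delta l k f x y := by
  unfold delta
  simp_rw [pdx_mul hf hg hx hy, pdy_mul hf hg hx hy, mul_add, Finset.sum_add_distrib, mul_sub,
    Finset.mul_sum, mul_left_comm]
  ring

theorem delta_sum {F : Fin n → Vec n → Vec n → ℝ} (hF : ∀ i, SlitSmooth U (F i)) (hx : x ∈ U)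
    (hy : y ≠ 0) (k : Fin n) :
    delta l k (fun x y => ∑ j, F j x y) x y = ∑ j, delta l k (F j) x y := by
  unfold delta
  simp_rw [pdx_sum hF hx hy, pdy_sum hF hx hy, Finset.mul_sum, Finset.sum_sub_distrib]
  rw [Finset.sum_comm]

/-- Contraction with y therefore does not commute with δ_k; `delta_sum_mul_coord` carries the
correction. -/
theorem delta_coord (k j : Fin n) (x y : Vec n) :
    delta l k (fun _ y => y j) x y = -nonlinConn l j k x y := by
  unfold delta
  simp [pdx_coord, pdy_coord]

theorem delta_sum_mul_coord {F : Fin n → Vec n → Vec n → ℝ} (hF : ∀ i, SlitSmooth U (F i))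
    (hx : x ∈ U) (hy : y ≠ 0) (k : Fin n) :
    delta l k (fun x y => ∑ i, F i x y * y i) x y
      = ∑ i, delta l k (F i) x y * y i - ∑ i, F i x y * nonlinConn l i k x y := by
  rw [delta_sum (fun i => (hF i).mul (slitSmooth_coord i)) hx hy, ← Finset.sum_sub_distrib]
  refine Finset.sum_congr rfl fun i _ => ?_
  rw [delta_mul (hF i) (slitSmooth_coord i) hx hy, delta_coord]
  ring

end Delta

/-! ### Metricity of the Cartan connection and its consequences. -/

namespace LocalFinsler

theorem cartanConn_symm (h : LocalFinsler U l) (hx : x ∈ U) (hy : y ≠ 0) (i j k : Fin n) :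
    cartanConn l i j k x y = cartanConn l i k j x y := by
  unfold cartanConn
  congr 1
  refine Finset.sum_congr rfl fun r _ => ?_
  rw [delta_congr (fun _ hx _ hy => h.metric_symm hx hy j k) hx hy r]
  ring

/-- The Christoffel symbols of the first kind of the Cartan connection. -/
theorem sum_metric_cartanConn (h : LocalFinsler U l) (hx : x ∈ U) (hy : y ≠ 0) (i j k : Fin n) :
    ∑ r, metric l i r x y * cartanConn l r j k x y = (1 / 2) * (delta l k (metric l i j) x y
      + delta l j (metric l i k) x y - delta l i (metric l j k) x y) := by
  rw [← h.sum_metric_invMetric hx hy (fun i => (1 / 2) * (delta l k (metric l i j) x y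
      + delta l j (metric l i k) x y - delta l i (metric l j k) x y)) i]
  refine Finset.sum_congr rfl fun r _ => ?_
  unfold cartanConn
  rw [Finset.mul_sum]
  congr 1
  exact Finset.sum_congr rfl fun _ _ => by ring

theorem sum_metric_christoffel (h : LocalFinsler U l) (hx : x ∈ U) (hy : y ≠ 0)
    (i j k : Fin n) :
    ∑ r, metric l i r x y * christoffel l r j k x y = (1 / 2) * (pdx k (metric l i j) x y
      + pdx j (metric l i k) x y - pdx i (metric l j k) x y) := by
  rw [← h.sum_metric_invMetric hx hy (fun i => (1 / 2) * (pdx k (metric l i j) x y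
      + pdx j (metric l i k) x y - pdx i (metric l j k) x y)) i]
  refine Finset.sum_congr rfl fun r _ => ?_
  unfold christoffel
  rw [Finset.mul_sum]
  congr 1
  exact Finset.sum_congr rfl fun _ _ => by ring

/-- The Cartan connection is metrical. -/
theorem delta_metric (h : LocalFinsler U l) (hx : x ∈ U) (hy : y ≠ 0) (i j k : Fin n) :
    delta l k (metric l i j) x y = ∑ r, metric l j r x y * cartanConn l r i k x y
      + ∑ r, metric l i r x y * cartanConn l r j k x y := by
  rw [h.sum_metric_cartanConn hx hy, h.sum_metric_cartanConn hx hy,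
    delta_congr (fun _ hx _ hy => h.metric_symm hx hy j i) hx hy k]
  ring_nf

/-- The torsion term of N drops out because C_ijk y^j = 0. -/
theorem sum_nonlinConn_mul (h : LocalFinsler U l) (hx : x ∈ U) (hy : y ≠ 0) (i : Fin n) :
    ∑ j, nonlinConn l i j x y * y j = ∑ r, ∑ s, christoffel l i r s x y * y r * y s := by
  have h1 : ∀ k, ∑ j, cartanUp l i j k x y * y j = 0 := fun k => by
    have h2 : ∀ j, cartanUp l i j k x y * y j
        = ∑ r, invMetric l i r x y / 2 * (pdy k (metric l r j) x y * y j) := fun j => by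
      unfold cartanUp cartanTensor
      rw [Finset.sum_mul]
      exact Finset.sum_congr rfl fun _ _ => by ring
    simp_rw [h2]
    rw [Finset.sum_comm]
    simp_rw [← Finset.mul_sum, h.sum_pdy_metric_mul hx hy]
    simp
  unfold nonlinConn
  simp_rw [sub_mul, Finset.sum_sub_distrib, Finset.sum_mul]
  rw [Finset.sum_comm (f := fun j k => cartanUp l i j k x y * _ * y j)]
  simp_rw [mul_right_comm (cartanUp l i _ _ x y), ← Finset.sum_mul, h1]
  simp only [zero_mul, Finset.sum_const_zero, sub_zero]
  refine Finset.sum_congr rfl fun j _ => ?_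
  rw [Finset.sum_mul]
  exact Finset.sum_congr rfl fun k _ => by ring

/-- The nonlinear connection is the contraction of the Cartan connection. -/
theorem nonlinConn_eq (h : LocalFinsler U l) (hx : x ∈ U) (hy : y ≠ 0) (i j : Fin n) :
    nonlinConn l i j x y = ∑ k, cartanConn l i j k x y * y k := by
  revert i
  refine congrFun (h.eq_of_sum_metric hx hy fun i => ?_)
  have hA : ∑ r, metric l i r x y * nonlinConn l r j x y
      = ∑ k, (1 / 2) * (pdx k (metric l i j) x y + pdx j (metric l i k) x y
          - pdx i (metric l j k) x y) * y k
        - ∑ k, cartanTensor l i j k x y * ∑ r, ∑ s, christoffel l k r s x y * y r * y s := by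
    have hG : ∀ G : Fin n → ℝ, ∑ r, metric l i r x y * ∑ k, cartanUp l r j k x y * G k
        = ∑ k, cartanTensor l i j k x y * G k := fun G => by
      simp_rw [Finset.mul_sum]
      rw [Finset.sum_comm]
      refine Finset.sum_congr rfl fun k _ => ?_
      rw [← h.sum_metric_invMetric hx hy (fun i => cartanTensor l i j k x y) i, Finset.sum_mul]
      refine Finset.sum_congr rfl fun r _ => ?_
      unfold cartanUp
      ring
    unfold nonlinConn
    simp_rw [mul_sub, Finset.sum_sub_distrib, hG, Finset.mul_sum]
    congr 1
    rw [Finset.sum_comm]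
    refine Finset.sum_congr rfl fun k _ => ?_
    rw [← mul_sub, ← h.sum_metric_christoffel hx hy, Finset.sum_mul]
    exact Finset.sum_congr rfl fun _ _ => by ring
  have hB : ∑ r, metric l i r x y * ∑ k, cartanConn l r j k x y * y k
      = ∑ k, (1 / 2) * (delta l k (metric l i j) x y + delta l j (metric l i k) x y
          - delta l i (metric l j k) x y) * y k := by
    simp_rw [Finset.mul_sum]
    rw [Finset.sum_comm]
    refine Finset.sum_congr rfl fun k _ => ?_
    rw [← h.sum_metric_cartanConn hx hy, Finset.sum_mul]
    exact Finset.sum_congr rfl fun _ _ => by ring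
  -- The part of δ_i involving N vanishes, as y^k ∂g_jk/∂y^r = 0.
  have hC : ∀ i j, ∑ k, delta l i (metric l j k) x y * y k
      = ∑ k, pdx i (metric l j k) x y * y k := fun i j => by
    unfold delta
    simp_rw [sub_mul, Finset.sum_sub_distrib, Finset.sum_mul]
    rw [Finset.sum_comm (f := fun k r => nonlinConn l r i x y * _ * y k)]
    simp_rw [mul_assoc, ← Finset.mul_sum, h.sum_pdy_metric_mul hx hy]
    simp
  -- Here N survives, through N^r_k y^k = γ^r_00. The factor 1/2 in `hB` turns this into the Cartan
  -- term of `hA`.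
  have hD : ∑ k, delta l k (metric l i j) x y * y k = ∑ k, pdx k (metric l i j) x y * y k
      - 2 * ∑ k, cartanTensor l i j k x y * ∑ r, ∑ s, christoffel l k r s x y * y r * y s := by
    simp_rw [← h.sum_nonlinConn_mul hx hy]
    unfold delta
    simp_rw [sub_mul, Finset.sum_sub_distrib, Finset.sum_mul]
    rw [Finset.sum_comm (f := fun k r => nonlinConn l r k x y * _ * y k), Finset.mul_sum]
    congr 1
    refine Finset.sum_congr rfl fun r _ => ?_
    rw [Finset.mul_sum, Finset.mul_sum]
    refine Finset.sum_congr rfl fun k _ => ?_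
    unfold cartanTensor
    ring
  rw [hA, hB]
  simp_rw [mul_assoc, ← Finset.mul_sum, sub_mul, add_mul, Finset.sum_sub_distrib,
    Finset.sum_add_distrib, hC, hD]
  ring_nf

theorem nonlinConn_eq' (h : LocalFinsler U l) (hx : x ∈ U) (hy : y ≠ 0) (i j : Fin n) :
    nonlinConn l i j x y = ∑ k, cartanConn l i k j x y * y k := by
  rw [h.nonlinConn_eq hx hy]
  exact Finset.sum_congr rfl fun k _ => by rw [h.cartanConn_symm hx hy]

theorem sum_delta_metric_mul (h : LocalFinsler U l) (hx : x ∈ U) (hy : y ≠ 0) (i k : Fin n) :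
    ∑ j, delta l k (metric l i j) x y * y j = ∑ r, l x y * L1 l r x y * cartanConn l r i k x y
      + ∑ r, metric l i r x y * nonlinConn l r k x y := by
  simp_rw [h.delta_metric hx hy, add_mul, Finset.sum_add_distrib, Finset.sum_mul]
  congr 1
  · rw [Finset.sum_comm]
    refine Finset.sum_congr rfl fun r _ => ?_
    rw [← h.sum_metric_mul hx hy, Finset.sum_mul]
    exact Finset.sum_congr rfl fun j _ => by rw [h.metric_symm hx hy]; ring
  · rw [Finset.sum_comm]
    refine Finset.sum_congr rfl fun r _ => ?_
    rw [h.nonlinConn_eq' hx hy, Finset.mul_sum]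
    exact Finset.sum_congr rfl fun j _ => by ring

/-- Since L L_i = g_ij y^j, the correction -g_ij N^j_k cancels one of the two metricity terms. -/
theorem delta_mul_L1 (h : LocalFinsler U l) (hx : x ∈ U) (hy : y ≠ 0) (i k : Fin n) :
    delta l k (fun x y => l x y * L1 l i x y) x y
      = l x y * ∑ r, L1 l r x y * cartanConn l r i k x y := by
  rw [← delta_congr (fun _ hx _ hy => h.sum_metric_mul hx hy i) hx hy k,
    delta_sum_mul_coord (fun j => h.smooth_metric i j) hx hy, h.sum_delta_metric_mul hx hy,
    Finset.mul_sum]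
  simp [mul_assoc]

/-- A Finsler metric function is horizontally constant. -/
theorem delta_self (h : LocalFinsler U l) (hx : x ∈ U) (hy : y ≠ 0) (k : Fin n) :
    delta l k l x y = 0 := by
  have h1 : delta l k (fun x y => l x y * l x y) x y = 0 := by
    -- With L² = (L L_i) y^i, the two resulting terms cancel because N is the contraction of Γ.
    have h2 : ∀ x ∈ U, ∀ y : Vec n, y ≠ 0 →
        l x y * l x y = ∑ i, (l x y * L1 l i x y) * y i := fun x hx y hy => by
      simp_rw [mul_assoc, ← Finset.mul_sum, h.sum_L1_mul hx hy]
    rw [delta_congr h2 hx hy k,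
      delta_sum_mul_coord (fun i => h.smooth.mul (h.smooth_L1 i)) hx hy]
    simp_rw [h.delta_mul_L1 hx hy, h.nonlinConn_eq' hx hy, mul_assoc, ← Finset.mul_sum,
      Finset.mul_sum, Finset.sum_mul]
    rw [Finset.sum_comm, sub_eq_zero]
    refine Finset.sum_congr rfl fun i _ => ?_
    rw [Finset.mul_sum]
    exact Finset.sum_congr rfl fun j _ => by ring
  rw [delta_mul h.smooth h.smooth hx hy] at h1
  have h3 := h.ne_zero hx hy
  have h4 : l x y * delta l k l x y = 0 := by linarith
  exact (mul_eq_zero.1 h4).resolve_left h3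

theorem delta_L1 (h : LocalFinsler U l) (hx : x ∈ U) (hy : y ≠ 0) (i k : Fin n) :
    delta l k (L1 l i) x y = ∑ r, L1 l r x y * cartanConn l r i k x y := by
  have h1 := h.delta_mul_L1 hx hy i k
  rw [delta_mul h.smooth (h.smooth_L1 i) hx hy, h.delta_self hx hy, mul_zero, add_zero] at h1
  exact mul_left_cancel₀ (h.ne_zero hx hy) h1

/-- In g_ij = L_i L_j + L L_ij everything except L_ij is already known to be parallel, and L ≠ 0. -/
theorem delta_L2 (h : LocalFinsler U l) (hx : x ∈ U) (hy : y ≠ 0) (i j k : Fin n) :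
    delta l k (L2 l i j) x y = ∑ r, L2 l j r x y * cartanConn l r i k x y
      + ∑ r, L2 l i r x y * cartanConn l r j k x y := by
  have h1 := h.delta_metric hx hy i j k
  rw [delta_congr (fun _ hx _ hy => h.metric_eq hx hy i j) hx hy k,
    delta_add ((h.smooth_L1 i).mul (h.smooth_L1 j)) (h.smooth.mul (h.smooth_L2 i j)) hx hy,
    delta_mul (h.smooth_L1 i) (h.smooth_L1 j) hx hy, delta_mul h.smooth (h.smooth_L2 i j) hx hy,
    h.delta_self hx hy, h.delta_L1 hx hy, h.delta_L1 hx hy] at h1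
  simp_rw [h.metric_eq hx hy, add_mul, Finset.sum_add_distrib, mul_assoc, ← Finset.mul_sum] at h1
  refine mul_left_cancel₀ (h.ne_zero hx hy) ?_
  linarith

end LocalFinsler

/-! ### Contractions of E, F and D, and comparison of two Cartan connections. -/

theorem sum_mul_linear_combination (u v F G : Fin n → ℝ) (c d e : ℝ) :
    ∑ r, u r * (c * v r + (d * F r - e * G r))
      = c * ∑ r, u r * v r + (d * ∑ r, u r * F r - e * ∑ r, u r * G r) := by
  simp_rw [Finset.mul_sum, ← Finset.sum_sub_distrib, ← Finset.sum_add_distrib]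
  exact Finset.sum_congr rfl fun _ _ => by ring

theorem sum_skewF_mul (i : Fin n) : ∑ j, skewF l b j i x y * y j = -skewF0 l b i x y := by
  unfold skewF0
  rw [← Finset.sum_neg_distrib]
  refine Finset.sum_congr rfl fun j _ => ?_
  unfold skewF
  ring

theorem sum_skewF0_mul : ∑ i, skewF0 l b i x y * y i = 0 := by
  have h1 : ∑ i, skewF0 l b i x y * y i = -∑ i, skewF0 l b i x y * y i := by
    conv_rhs => rw [← Finset.sum_neg_distrib]
    simp_rw [← neg_mul, ← sum_skewF_mul]
    unfold skewF0
    simp_rw [Finset.sum_mul]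
    rw [Finset.sum_comm]
    exact Finset.sum_congr rfl fun _ _ => Finset.sum_congr rfl fun _ _ => by ring
  linarith

theorem sum_symE0_mul : ∑ i, symE0 l b i x y * y i = symE00 l b x y := by
  unfold symE0 symE00
  simp_rw [Finset.sum_mul]
  rw [Finset.sum_comm]

theorem hcov_eq (i j : Fin n) :
    hcov l (fun r x' _ => b r x') i j x y = symE l b i j x y + skewF l b i j x y := by
  unfold symE skewF
  ring

theorem sum_diff0_mul (r : Fin n) :
    ∑ k, diff0 l lb r k x y * y k = diff00 l lb r x y := by
  unfold diff0 diff00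
  simp_rw [Finset.sum_mul]
  rw [Finset.sum_comm]

namespace LocalFinsler

/-- Used to turn b_r g^rk F_k0 into F_β0 and b_r σ^r into σ_β. -/
theorem sum_invMetric_comm (h : LocalFinsler U l) (hx : x ∈ U) (hy : y ≠ 0) (u v : Fin n → ℝ) :
    ∑ r, u r * ∑ k, invMetric l r k x y * v k = ∑ r, v r * ∑ k, invMetric l r k x y * u k := by
  simp_rw [Finset.mul_sum]
  rw [Finset.sum_comm]
  exact Finset.sum_congr rfl fun i _ => Finset.sum_congr rfl fun j _ => by
    rw [h.invMetric_symm hx hy]; ring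

/-- The vector `F^r_0`, obtained by raising the index of `F_k0`, is tangent to the indicatrix. -/
theorem sum_L1_mul_skewF0Up (h : LocalFinsler U l) (hx : x ∈ U) (hy : y ≠ 0) :
    ∑ r, L1 l r x y * ∑ k, invMetric l r k x y * skewF0 l b k x y = 0 := by
  set F : Fin n → ℝ := fun r => ∑ k, invMetric l r k x y * skewF0 l b k x y
  -- As L L_r = g_ri y^i, the claim reduces to F_i0 y^i = 0, which is skewness.
  have h1 : ∑ i, (∑ r, metric l i r x y * F r) * y i = 0 := by
    rw [← sum_skewF0_mul (l := l) (b := b) (x := x) (y := y)]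
    exact Finset.sum_congr rfl fun i _ => by rw [h.sum_metric_invMetric hx hy]
  have h2 : ∑ i, (∑ r, metric l i r x y * F r) * y i = l x y * ∑ r, L1 l r x y * F r := by
    simp_rw [Finset.sum_mul]
    rw [Finset.sum_comm, Finset.mul_sum]
    refine Finset.sum_congr rfl fun r _ => ?_
    rw [← mul_assoc, ← h.sum_metric_mul hx hy, Finset.sum_mul]
    exact Finset.sum_congr rfl fun i _ => by rw [h.metric_symm hx hy]; ring
  rw [h1] at h2
  exact (mul_eq_zero.1 h2.symm).resolve_left (h.ne_zero hx hy)

theorem sum_L2_mul_skewF0Up (h : LocalFinsler U l) (hx : x ∈ U) (hy : y ≠ 0) (i : Fin n) :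
    l x y * ∑ r, L2 l i r x y * ∑ k, invMetric l r k x y * skewF0 l b k x y
      = skewF0 l b i x y := by
  have h1 := h.sum_metric_invMetric hx hy (fun k => skewF0 l b k x y) i
  simp_rw [h.metric_eq hx hy, add_mul, Finset.sum_add_distrib, mul_assoc, ← Finset.mul_sum,
    h.sum_L1_mul_skewF0Up hx hy] at h1
  linarith

/-- Contract `cartanTensor_eq` with F^r_0 = g^rk F_k0, for which L_r F^r_0 = 0 and L L_ir F^r_0 =
F_i0. -/
theorem sum_L3_mul_skewF0Up (h : LocalFinsler U l) (hx : x ∈ U) (hy : y ≠ 0) (i j : Fin n) :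
    l x y * ∑ r, L3 l i j r x y * ∑ k, invMetric l r k x y * skewF0 l b k x y
      = 2 * ∑ k, cartanUp l k i j x y * skewF0 l b k x y
        - 1 / l x y * (L1 l i x y * skewF0 l b j x y + L1 l j x y * skewF0 l b i x y) := by
  have h0 := h.ne_zero hx hy
  have h1 : ∑ k, cartanUp l k i j x y * skewF0 l b k x y
      = ∑ r, cartanTensor l i j r x y * ∑ k, invMetric l r k x y * skewF0 l b k x y := by
    rw [h.sum_invMetric_comm hx hy]
    refine Finset.sum_congr rfl fun k _ => ?_
    unfold cartanUp
    simp_rw [fun r => h.cartanTensor_rotate hx hy r i j, mul_comm]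
  have h2 : ∀ r F, 2 * (cartanTensor l i j r x y * F) = L1 l j x y * (L2 l i r x y * F)
      + L1 l i x y * (L2 l j r x y * F) + L2 l i j x y * (L1 l r x y * F)
      + l x y * (L3 l i j r x y * F) := fun r F => by
    rw [← mul_assoc, h.cartanTensor_eq hx hy]; ring
  rw [h1, Finset.mul_sum (a := 2)]
  simp_rw [h2, Finset.sum_add_distrib, ← Finset.mul_sum, h.sum_L1_mul_skewF0Up hx hy]
  have h3 := h.sum_L2_mul_skewF0Up (b := b) hx hy i
  have h4 := h.sum_L2_mul_skewF0Up (b := b) hx hy j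
  rw [← h3, ← h4]
  field_simp
  ring

theorem diffT_symm (h : LocalFinsler U l) (hb : LocalFinsler U lb) (hx : x ∈ U) (hy : y ≠ 0)
    (i j k : Fin n) : diffT l lb i j k x y = diffT l lb i k j x y := by
  unfold diffT
  rw [h.cartanConn_symm hx hy, hb.cartanConn_symm hx hy]

theorem sum_diffT_mul (h : LocalFinsler U l) (hb : LocalFinsler U lb) (hx : x ∈ U) (hy : y ≠ 0)
    (r i : Fin n) : ∑ k, diffT l lb r i k x y * y k = diff0 l lb r i x y :=
  Finset.sum_congr rfl fun k _ => by rw [h.diffT_symm hb hx hy]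

theorem diff0_eq (h : LocalFinsler U l) (hb : LocalFinsler U lb) (hx : x ∈ U) (hy : y ≠ 0)
    (r k : Fin n) : diff0 l lb r k x y = nonlinConn lb r k x y - nonlinConn l r k x y := by
  rw [h.nonlinConn_eq' hx hy, hb.nonlinConn_eq' hx hy, ← Finset.sum_sub_distrib]
  exact Finset.sum_congr rfl fun _ _ => by unfold diffT; ring

/-- The nonlinear connections differ by D^r_0k; this is how the difference tensor enters. -/
theorem delta_eq_sub (h : LocalFinsler U l) (hb : LocalFinsler U lb) (hx : x ∈ U) (hy : y ≠ 0)
    (k : Fin n) (f : Vec n → Vec n → ℝ) :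
    delta lb k f x y = delta l k f x y - ∑ r, pdy r f x y * diff0 l lb r k x y := by
  unfold delta
  simp_rw [h.diff0_eq hb hx hy, mul_sub, Finset.sum_sub_distrib, mul_comm (pdy _ f x y)]
  ring

end LocalFinsler

theorem delta_position (u : Vec n → ℝ) (k : Fin n) :
    delta l k (fun x _ => u x) x y = sig u k x := by
  unfold delta
  simp_rw [pdy_position]
  simp [pdx, sig]

theorem sig_exp (hs : DifferentiableAt ℝ s x) (k : Fin n) :
    sig (fun x => Real.exp (s x)) k x = Real.exp (s x) * sig s k x := by
  unfold sig
  rw [fderiv_exp hs]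
  rfl

/-! ### The equations of the β-conformal change and their solution. -/

/-- The coordinate expression of a `β`-conformal change of Finsler metric functions. -/
structure LocalBetaChange (U : Opens (Vec n)) (l lb : Vec n → Vec n → ℝ) (s : Vec n → ℝ)
    (b : Fin n → Vec n → ℝ) : Prop where
  finsler : LocalFinsler U l
  finsler' : LocalFinsler U lb
  smooth_s : ContDiffOn ℝ ∞ s U
  smooth_b : ∀ i, ContDiffOn ℝ ∞ (b i) U
  change : ∀ x ∈ U, ∀ y, lb x y = Real.exp (s x) * l x y + ∑ i, b i x * y i

namespace LocalBetaChange

theorem smooth_exp (h : LocalBetaChange U l lb s b) :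
    SlitSmooth U fun x _ => Real.exp (s x) := slitSmooth_position h.smooth_s.exp

theorem smooth_form (h : LocalBetaChange U l lb s b) (i : Fin n) :
    SlitSmooth U fun x _ => b i x := slitSmooth_position (h.smooth_b i)

theorem L1_eq (h : LocalBetaChange U l lb s b) (hx : x ∈ U) (hy : y ≠ 0) (i : Fin n) :
    L1 lb i x y = Real.exp (s x) * L1 l i x y + b i x := by
  unfold L1
  rw [pdy_congr (fun x hx y _ => h.change x hx y) hx hy i,
    pdy_add (h.smooth_exp.mul h.finsler.smooth)
      (SlitSmooth.sum fun i => (h.smooth_form i).mul (slitSmooth_coord i)) hx hy,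
    pdy_mul h.smooth_exp h.finsler.smooth hx hy, LocalFinsler.pdy_sum_mul_coord h.smooth_form hx hy,
    pdy_position (fun x => Real.exp (s x))]
  simp [pdy_position]

theorem L2_eq (h : LocalBetaChange U l lb s b) (hx : x ∈ U) (hy : y ≠ 0) (i j : Fin n) :
    L2 lb i j x y = Real.exp (s x) * L2 l i j x y := by
  unfold L2
  rw [pdy_congr (fun _ hx _ hy => h.L1_eq hx hy i) hx hy j,
    pdy_add (h.smooth_exp.mul (h.finsler.smooth_L1 i)) (h.smooth_form i) hx hy,
    pdy_mul h.smooth_exp (h.finsler.smooth_L1 i) hx hy, pdy_position (fun x => Real.exp (s x)),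
    pdy_position]
  ring

theorem delta_exp (h : LocalBetaChange U l lb s b) (hx : x ∈ U) (k : Fin n) :
    delta lb k (fun x _ => Real.exp (s x)) x y = Real.exp (s x) * sig s k x := by
  rw [delta_position (fun x => Real.exp (s x)), sig_exp]
  exact (h.smooth_s.contDiffAt (U.isOpen.mem_nhds hx)).differentiableAt (by simp)

/-- Both Cartan connections being metrical, the difference tensor satisfies an equation of
second order in the angular tensors. -/
theorem sig_mul_L2 (h : LocalBetaChange U l lb s b) (hx : x ∈ U) (hy : y ≠ 0) (i j k : Fin n) :
    sig s k x * L2 l i j x y = ∑ r, L3 l i j r x y * diff0 l lb r k x y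
      + ∑ r, L2 l j r x y * diffT l lb r i k x y + ∑ r, L2 l i r x y * diffT l lb r j k x y := by
  -- Parallelism of e^σ L_ij for the changed connection, compared with that of L_ij for the original
  -- one.
  have h1 := h.finsler'.delta_L2 hx hy i j k
  rw [delta_congr (fun _ hx _ hy => h.L2_eq hx hy i j) hx hy k,
    delta_mul h.smooth_exp (h.finsler.smooth_L2 i j) hx hy, h.delta_exp hx,
    h.finsler.delta_eq_sub h.finsler' hx hy, h.finsler.delta_L2 hx hy] at h1
  simp_rw [h.L2_eq hx hy, mul_assoc, ← Finset.mul_sum] at h1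
  have h2 : ∀ j i, ∑ r, L2 l j r x y * diffT l lb r i k x y
      = ∑ r, L2 l j r x y * cartanConn lb r i k x y
        - ∑ r, L2 l j r x y * cartanConn l r i k x y := fun j i => by
    simp_rw [diffT, mul_sub, Finset.sum_sub_distrib]
  rw [h2, h2]
  change Real.exp (s x) * (_ - ∑ r, L3 l i j r x y * diff0 l lb r k x y) + _ = _ at h1
  refine mul_left_cancel₀ (Real.exp_pos (s x)).ne' ?_
  linarith

/-- The argument of `sig_mul_L2` one order lower, with L'_i = e^σ L_i + b_i. -/
theorem hcov_add (h : LocalBetaChange U l lb s b) (hx : x ∈ U) (hy : y ≠ 0) (i k : Fin n) :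
    hcov l (fun r x' _ => b r x') i k x y + Real.exp (s x) * (sig s k x * L1 l i x y)
      = Real.exp (s x) * ∑ r, L2 l i r x y * diff0 l lb r k x y
        + ∑ r, L1 lb r x y * diffT l lb r i k x y := by
  have h1 := h.finsler'.delta_L1 hx hy i k
  rw [delta_congr (fun _ hx _ hy => h.L1_eq hx hy i) hx hy k,
    delta_add (h.smooth_exp.mul (h.finsler.smooth_L1 i)) (h.smooth_form i) hx hy,
    delta_mul h.smooth_exp (h.finsler.smooth_L1 i) hx hy, h.delta_exp hx,
    h.finsler.delta_eq_sub h.finsler' hx hy, h.finsler.delta_L1 hx hy, delta_position] at h1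
  have h2 : ∑ r, L1 lb r x y * diffT l lb r i k x y
      = ∑ r, L1 lb r x y * cartanConn lb r i k x y
        - (Real.exp (s x) * ∑ r, L1 l r x y * cartanConn l r i k x y
          + ∑ r, b r x * cartanConn l r i k x y) := by
    simp_rw [diffT, mul_sub, Finset.sum_sub_distrib, Finset.mul_sum, ← Finset.sum_add_distrib]
    congr 1
    exact Finset.sum_congr rfl fun r _ => by rw [h.L1_eq hx hy]; ring
  change Real.exp (s x) * (_ - ∑ r, L2 l i r x y * diff0 l lb r k x y) + _ + _ = _ at h1
  rw [h2]
  unfold hcov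
  rw [delta_position]
  linarith

theorem sig0_mul_L2 (h : LocalBetaChange U l lb s b) (hx : x ∈ U) (hy : y ≠ 0) (i j : Fin n) :
    sig0 s x y * L2 l i j x y = ∑ r, L3 l i j r x y * diff00 l lb r x y
      + ∑ r, L2 l j r x y * diff0 l lb r i x y + ∑ r, L2 l i r x y * diff0 l lb r j x y := by
  have h1 : sig0 s x y * L2 l i j x y = ∑ k, (sig s k x * L2 l i j x y) * y k := by
    unfold sig0
    rw [Finset.sum_mul]
    exact Finset.sum_congr rfl fun _ _ => by ring
  rw [h1]
  simp_rw [h.sig_mul_L2 hx hy, add_mul, Finset.sum_add_distrib, Finset.sum_mul]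
  congr 1
  · congr 1
    · rw [Finset.sum_comm]
      simp_rw [mul_assoc, ← Finset.mul_sum, sum_diff0_mul]
    · rw [Finset.sum_comm]
      simp_rw [mul_assoc, ← Finset.mul_sum, h.finsler.sum_diffT_mul h.finsler' hx hy]
  · rw [Finset.sum_comm]
    simp_rw [mul_assoc, ← Finset.mul_sum, h.finsler.sum_diffT_mul h.finsler' hx hy]

/-- Antisymmetrizing `hcov_add` removes L'_r D^r_ik, since D is symmetric in its lower indices. -/
theorem skewF_eq (h : LocalBetaChange U l lb s b) (hx : x ∈ U) (hy : y ≠ 0) (i j : Fin n) :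
    2 * skewF l b i j x y - Real.exp (s x) * muT l s i j x y
      = Real.exp (s x) * (∑ r, L2 l i r x y * diff0 l lb r j x y
        - ∑ r, L2 l j r x y * diff0 l lb r i x y) := by
  have h1 := h.hcov_add hx hy i j
  have h2 := h.hcov_add hx hy j i
  simp_rw [h.finsler.diffT_symm h.finsler' hx hy _ j i] at h2
  unfold skewF muT
  linarith

/-- `sig0_mul_L2` gives the symmetric part in i, j and `skewF_eq` the skew part. -/
theorem sum_L2_mul_diff0 (h : LocalBetaChange U l lb s b) (hx : x ∈ U) (hy : y ≠ 0)
    (i j : Fin n) :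
    ∑ r, L2 l i r x y * diff0 l lb r j x y = tensorG l lb s b i j x y := by
  have h1 := h.sig0_mul_L2 hx hy i j
  have h2 := h.skewF_eq hx hy i j
  have h3 : Real.exp (-s x) * Real.exp (s x) = 1 := by rw [← Real.exp_add]; simp
  have h4 := congrArg (Real.exp (-s x) * ·) h2
  simp only [mul_sub, ← mul_assoc, h3, one_mul] at h4
  unfold tensorG
  linarith

/-- Contract `skewF_eq` with y^j; the second sum dies by L_jr y^j = 0. -/
theorem sum_L2_mul_diff00 (h : LocalBetaChange U l lb s b) (hx : x ∈ U) (hy : y ≠ 0)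
    (i : Fin n) :
    ∑ r, L2 l i r x y * diff00 l lb r x y = 2 * Real.exp (-s x) * skewF0 l b i x y
      + (sig0 s x y * L1 l i x y - sig s i x * l x y) := by
  have h1 : ∑ j, (2 * skewF l b i j x y - Real.exp (s x) * muT l s i j x y) * y j
      = 2 * skewF0 l b i x y
        - Real.exp (s x) * (sig s i x * l x y - sig0 s x y * L1 l i x y) := by
    rw [← h.finsler.sum_L1_mul hx hy]
    unfold skewF0 sig0 muT
    simp_rw [Finset.mul_sum, Finset.sum_mul, ← Finset.sum_sub_distrib, Finset.mul_sum,
      ← Finset.sum_sub_distrib]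
    exact Finset.sum_congr rfl fun _ _ => by ring
  have h2 : ∑ j, (∑ r, L2 l i r x y * diff0 l lb r j x y) * y j
      = ∑ r, L2 l i r x y * diff00 l lb r x y := by
    simp_rw [Finset.sum_mul]
    rw [Finset.sum_comm]
    simp_rw [mul_assoc, ← Finset.mul_sum, sum_diff0_mul]
  have h3 : ∑ j, (∑ r, L2 l j r x y * diff0 l lb r i x y) * y j = 0 := by
    simp_rw [Finset.sum_mul]
    rw [Finset.sum_comm]
    refine Finset.sum_eq_zero fun r _ => ?_
    rw [← zero_mul (diff0 l lb r i x y), ← h.finsler.sum_L2_mul hx hy r, Finset.sum_mul]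
    exact Finset.sum_congr rfl fun _ _ => mul_right_comm _ _ _
  simp_rw [h.skewF_eq hx hy, mul_assoc, ← Finset.mul_sum, sub_mul, Finset.sum_sub_distrib, h2,
    h3] at h1
  have h4 : Real.exp (-s x) * Real.exp (s x) = 1 := by rw [← Real.exp_add]; simp
  refine mul_left_cancel₀ (Real.exp_pos (s x)).ne' ?_
  linear_combination h1 - 2 * skewF0 l b i x y * h4

/-- Contract `hcov_add` with y^i; again L_ir y^i = 0 removes one term. -/
theorem sum_L1_mul_diff0 (h : LocalBetaChange U l lb s b) (hx : x ∈ U) (hy : y ≠ 0)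
    (k : Fin n) :
    ∑ r, L1 lb r x y * diff0 l lb r k x y = symE0 l b k x y - skewF0 l b k x y
      + Real.exp (s x) * (sig s k x * l x y) := by
  have h1 : ∑ i, (hcov l (fun r x' _ => b r x') i k x y
      + Real.exp (s x) * (sig s k x * L1 l i x y)) * y i
      = symE0 l b k x y - skewF0 l b k x y + Real.exp (s x) * (sig s k x * l x y) := by
    simp_rw [hcov_eq, add_mul, Finset.sum_add_distrib, sum_skewF_mul, mul_assoc,
      ← Finset.mul_sum, h.finsler.sum_L1_mul hx hy]
    unfold symE0
    ring
  have h2 : ∑ i, (∑ r, L2 l i r x y * diff0 l lb r k x y) * y i = 0 := by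
    simp_rw [Finset.sum_mul]
    rw [Finset.sum_comm]
    refine Finset.sum_eq_zero fun r _ => ?_
    rw [← zero_mul (diff0 l lb r k x y), ← h.finsler.sum_L2_mul hx hy r, Finset.sum_mul]
    exact Finset.sum_congr rfl fun _ _ => mul_right_comm _ _ _
  have h3 : ∑ i, (∑ r, L1 lb r x y * diffT l lb r i k x y) * y i
      = ∑ r, L1 lb r x y * diff0 l lb r k x y := by
    simp_rw [Finset.sum_mul]
    rw [Finset.sum_comm]
    simp_rw [mul_assoc, ← Finset.mul_sum]
    rfl
  rw [← h1]
  simp_rw [h.hcov_add hx hy, add_mul, Finset.sum_add_distrib, h3, mul_assoc, ← Finset.mul_sum, h2]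
  simp

theorem sum_L1_mul_diff00 (h : LocalBetaChange U l lb s b) (hx : x ∈ U) (hy : y ≠ 0) :
    ∑ r, L1 lb r x y * diff00 l lb r x y
      = symE00 l b x y + Real.exp (s x) * (sig0 s x y * l x y) := by
  have h1 : ∑ r, L1 lb r x y * diff00 l lb r x y
      = ∑ k, (∑ r, L1 lb r x y * diff0 l lb r k x y) * y k := by
    simp_rw [Finset.sum_mul]
    rw [Finset.sum_comm]
    simp_rw [mul_assoc, ← Finset.mul_sum, sum_diff0_mul]
  rw [h1]
  simp_rw [h.sum_L1_mul_diff0 hx hy, add_mul, sub_mul, Finset.sum_add_distrib,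
    Finset.sum_sub_distrib, sum_symE0_mul, sum_skewF0_mul, sig0, Finset.sum_mul, Finset.mul_sum]
  rw [sub_zero]
  congr 1
  exact Finset.sum_congr rfl fun _ _ => by ring

/-- The vector `D^r_00`, up to its component along the supporting element. -/
theorem diff00_eq (h : LocalBetaChange U l lb s b) (hx : x ∈ U) (hy : y ≠ 0) (r : Fin n) :
    diff00 l lb r x y
      = ((∑ k, L1 l k x y * diff00 l lb k x y) / l x y + sig0 s x y) * y r
        + (2 * l x y * Real.exp (-s x) * ∑ k, invMetric l r k x y * skewF0 l b k x y
          - l x y ^ 2 * sigUp l s r x y) := by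
  revert r
  refine congrFun (h.finsler.eq_of_sum_metric hx hy fun i => ?_)
  -- After lowering, y^r becomes L L_i. The summand σ_0 y^r thus accounts for the term σ_0 L_i of
  -- `sum_L2_mul_diff00`.
  have h0 := h.finsler.ne_zero hx hy
  rw [sum_mul_linear_combination (fun r => metric l i r x y), h.finsler.sum_metric_mul hx hy]
  simp_rw [sigUp, h.finsler.sum_metric_invMetric hx hy]
  simp_rw [h.finsler.metric_eq hx hy, add_mul, Finset.sum_add_distrib, mul_assoc,
    ← Finset.mul_sum, h.sum_L2_mul_diff00 hx hy]
  field_simp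
  ring

theorem component_diff00 (h : LocalBetaChange U l lb s b) (hx : x ∈ U) (hy : y ≠ 0) :
    (∑ k, L1 l k x y * diff00 l lb k x y) / l x y + sig0 s x y
      = (symE00 l b x y + 2 * Real.exp (s x) * sig0 s x y * l x y
        - 2 * l x y * Real.exp (-s x) * skewFβ0 l b x y + l x y ^ 2 * sigβ l s b x y)
          / lb x y := by
  have h0 := h.finsler.ne_zero hx hy
  have h0' := h.finsler'.ne_zero hx hy
  set c := (∑ k, L1 l k x y * diff00 l lb k x y) / l x y + sig0 s x y with hc
  have h1 : ∑ r, b r x * diff00 l lb r x y = c * ∑ r, b r x * y r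
      + (2 * l x y * Real.exp (-s x) * skewFβ0 l b x y - l x y ^ 2 * sigβ l s b x y) := by
    have h5 : ∀ r, diff00 l lb r x y = c * y r
        + (2 * l x y * Real.exp (-s x) * ∑ k, invMetric l r k x y * skewF0 l b k x y
          - l x y ^ 2 * sigUp l s r x y) := h.diff00_eq hx hy
    simp_rw [h5]
    rw [sum_mul_linear_combination (fun r => b r x)]
    unfold sigUp
    rw [h.finsler.sum_invMetric_comm hx hy, h.finsler.sum_invMetric_comm hx hy (fun r => b r x)]
    unfold skewFβ0 sigβ bUp
    ring
  -- L'_r D^r_00 = e^σ L_r D^r_00 + b_r D^r_00 is now affine in c, with leading coefficient e^σ L +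
  -- β = L'.
  have h2 := h.sum_L1_mul_diff00 hx hy
  simp_rw [h.L1_eq hx hy, add_mul, Finset.sum_add_distrib, mul_assoc, ← Finset.mul_sum, h1] at h2
  have h3 : ∑ k, L1 l k x y * diff00 l lb k x y = (c - sig0 s x y) * l x y := by
    rw [hc]; field_simp; ring
  rw [h3] at h2
  have h4 := h.change x hx y
  rw [eq_div_iff h0', h4]
  linear_combination h2

/-- The tensor `G_ij` without the difference tensor. -/
theorem tensorG_eq (h : LocalBetaChange U l lb s b) (hx : x ∈ U) (hy : y ≠ 0) (i j : Fin n) :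
    tensorG l lb s b i j x y =
      Real.exp (-s x) * skewF l b i j x y
      + Real.exp (-s x) / l x y * (L1 l i x y * skewF0 l b j x y + L1 l j x y * skewF0 l b i x y)
      - 2 * Real.exp (-s x) * ∑ k, cartanUp l k i j x y * skewF0 l b k x y
      + 1 / (2 * l x y * lb x y)
          * (symE00 l b x y - 2 * l x y * Real.exp (-s x) * skewFβ0 l b x y) * angular l i j x y
      + (1 / 2) * (l x y ^ 2 * ∑ r, L3 l i j r x y * sigUp l s r x y
          + l x y ^ 2 / lb x y * L2 l i j x y * sigβ l s b x y
          + (sig0 s x y * L2 l i j x y - muT l s i j x y))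
      + l x y / lb x y * Real.exp (s x) * sig0 s x y * L2 l i j x y := by
  have h0 := h.finsler.ne_zero hx hy
  have h0' := h.finsler'.ne_zero hx hy
  have h1 : ∑ r, L3 l i j r x y * diff00 l lb r x y
      = -(symE00 l b x y + 2 * Real.exp (s x) * sig0 s x y * l x y
        - 2 * l x y * Real.exp (-s x) * skewFβ0 l b x y + l x y ^ 2 * sigβ l s b x y)
          / lb x y * L2 l i j x y
        + 2 * Real.exp (-s x) * (l x y * ∑ r, L3 l i j r x y
            * ∑ k, invMetric l r k x y * skewF0 l b k x y)
        - l x y ^ 2 * ∑ r, L3 l i j r x y * sigUp l s r x y := by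
    have h5 := h.diff00_eq hx hy
    rw [h.component_diff00 hx hy] at h5
    simp_rw [h5]
    rw [sum_mul_linear_combination (fun r => L3 l i j r x y), h.finsler.sum_L3_mul₃ hx hy]
    ring
  rw [h.finsler.sum_L3_mul_skewF0Up hx hy] at h1
  unfold tensorG angular
  rw [h1]
  field_simp
  ring

theorem covectorG_eq (h : LocalBetaChange U l lb s b) (hx : x ∈ U) (hy : y ≠ 0) (i : Fin n) :
    covectorG l lb s b i x y = symE0 l b i x y - skewF0 l b i x y
      + Real.exp (s x) * (sig s i x * l x y) := by
  have h4 : Real.exp (-s x) * Real.exp (s x) = 1 := by rw [← Real.exp_add]; simp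
  unfold covectorG
  rw [h.sum_L2_mul_diff00 hx hy]
  linear_combination (-skewF0 l b i x y) * h4

end LocalBetaChange

end LocalTheory

/-! ### Passage from the manifold to charts, and the Riemannian case. -/

section Charts

variable {n : ℕ} {M : Type*} [TopologicalSpace M] [ChartedSpace (EuclideanSpace ℝ (Fin n)) M]

theorem IsFinsler.localFinsler [IsManifold (𝓡 n) ∞ M] {L : ∀ p : M, TangentSpace (𝓡 n) p → ℝ}
    (hL : IsFinsler L) {e : OpenPartialHomeomorph M (EuclideanSpace ℝ (Fin n))}
    (he : e ∈ IsManifold.maximalAtlas (𝓡 n) ∞ M) :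
    LocalFinsler ⟨e.target, e.open_target⟩ (localRep e L) where
  smooth := hL.smooth e he
  homogeneous x _ y c hc := by
    unfold localRep
    rw [← hL.homogeneous _ c _ hc]
    exact congrArg _ ((mfderiv (𝓡 n) (𝓡 n) e.symm x).map_smul c y)
  posDef := hL.posDef e he

theorem localRep_betaConformal (σ : M → ℝ) (β : ∀ p : M, TangentSpace (𝓡 n) p →L[ℝ] ℝ)
    (L : ∀ p : M, TangentSpace (𝓡 n) p → ℝ)
    (e : OpenPartialHomeomorph M (EuclideanSpace ℝ (Fin n))) (x y : Vec n) :
    localRep e (betaConformal σ β L) x y = Real.exp (σ (e.symm x)) * localRep e L x y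
      + ∑ i, oneFormComp e β i x * y i := by
  unfold localRep betaConformal oneFormComp
  congr 1
  -- Tangent spaces unfold to the model space, so the composite is a linear form on `Vec n` and can
  -- be expanded in the basis.
  let A : Vec n →L[ℝ] ℝ := (β (e.symm x)).comp (mfderiv (𝓡 n) (𝓡 n) e.symm x)
  change A y = ∑ i, A (EuclideanSpace.single i 1) * y i
  conv_lhs => rw [← (EuclideanSpace.basisFun (Fin n) ℝ).sum_repr y]
  simp [mul_comm]

theorem localBetaChange_of_isFinsler [IsManifold (𝓡 n) ∞ M]
    {L : ∀ p : M, TangentSpace (𝓡 n) p → ℝ} {σ : M → ℝ}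
    {β : ∀ p : M, TangentSpace (𝓡 n) p →L[ℝ] ℝ}
    (hL : IsFinsler L) (hσ : ContMDiff (𝓡 n) 𝓘(ℝ) ∞ σ) (hβ : IsSmoothOneForm β)
    (hLb : IsFinsler (betaConformal σ β L))
    {e : OpenPartialHomeomorph M (EuclideanSpace ℝ (Fin n))}
    (he : e ∈ IsManifold.maximalAtlas (𝓡 n) ∞ M) :
    LocalBetaChange ⟨e.target, e.open_target⟩ (localRep e L)
      (localRep e (betaConformal σ β L)) (fun x => σ (e.symm x)) (oneFormComp e β) where
  finsler := hL.localFinsler he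
  finsler' := hLb.localFinsler he
  smooth_s := contMDiffOn_iff_contDiffOn.1
    (hσ.comp_contMDiffOn (contMDiffOn_symm_of_mem_maximalAtlas he))
  smooth_b := hβ e he
  change x _ y := localRep_betaConformal σ β L e x y

/-- A quadratic energy on the single fibre over x suffices: g_ij involves only y-derivatives. -/
theorem metric_of_energy_eq {l : Vec n → Vec n → ℝ} {x : Vec n} (Q : Vec n →L[ℝ] Vec n →L[ℝ] ℝ)
    (hQ : ∀ u v, Q u v = Q v u) (h : ∀ y, energy l x y = Q y y / 2) (i j : Fin n) (y : Vec n) :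
    metric l i j x y = Q (EuclideanSpace.single i 1) (EuclideanSpace.single j 1) := by
  have h1 : ∀ y, pdy j (energy l) x y = Q y (EuclideanSpace.single j 1) := fun y => by
    unfold pdy
    have h2 : HasFDerivAt (fun y => Q y y / 2) ((2 : ℝ)⁻¹ • (Q y + Q.flip y)) y := by
      have h3 := (Q.hasFDerivAt (x := y)).clm_apply (hasFDerivAt_id y)
      simpa [div_eq_inv_mul] using h3.const_mul (2 : ℝ)⁻¹
    rw [funext h, h2.fderiv]
    simp [hQ _ y]
    ring
  unfold metric
  change fderiv ℝ (fun y => pdy j (energy l) x y) y _ = _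
  simp_rw [h1]
  change fderiv ℝ (Q.flip (EuclideanSpace.single j 1)) y _ = _
  rw [ContinuousLinearMap.fderiv]
  rfl

theorem cartanUp_eq_zero_of_energy_eq {l : Vec n → Vec n → ℝ} {x : Vec n}
    (Q : Vec n →L[ℝ] Vec n →L[ℝ] ℝ) (hQ : ∀ u v, Q u v = Q v u)
    (h : ∀ y, energy l x y = Q y y / 2) (i j k : Fin n) (y : Vec n) :
    cartanUp l i j k x y = 0 := by
  unfold cartanUp cartanTensor pdy
  simp_rw [metric_of_energy_eq Q hQ h]
  simp

theorem IsRiemannian.exists_bilinear [IsManifold (𝓡 n) ∞ M]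
    {L : ∀ p : M, TangentSpace (𝓡 n) p → ℝ} (hL : IsRiemannian L) (p : M) :
    ∃ B : Vec n →L[ℝ] Vec n →L[ℝ] ℝ, (∀ u v, B u v = B v u) ∧ (∀ u, 0 ≤ B u u) ∧
      ∀ u : TangentSpace (𝓡 n) p, L p u = Real.sqrt (B u u) := by
  obtain ⟨a, ha⟩ := hL
  refine ⟨a.inner p, a.symm p, fun u => ?_, ha p⟩
  by_cases h0 : u = 0
  · rw [h0, map_zero]
  · exact (a.pos p u h0).le

/-- The Cartan tensor of a Riemannian metric vanishes. -/
theorem IsRiemannian.cartanUp_eq_zero [IsManifold (𝓡 n) ∞ M]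
    {L : ∀ p : M, TangentSpace (𝓡 n) p → ℝ} (hL : IsRiemannian L)
    (e : OpenPartialHomeomorph M (EuclideanSpace ℝ (Fin n))) (i j k : Fin n) (x y : Vec n) :
    cartanUp (localRep e L) i j k x y = 0 := by
  obtain ⟨B, hsymm, hpos, hB⟩ := hL.exists_bilinear (e.symm x)
  let A : Vec n →L[ℝ] Vec n := mfderiv (𝓡 n) (𝓡 n) e.symm x
  refine cartanUp_eq_zero_of_energy_eq (B.bilinearComp A A) (fun u v => hsymm _ _)
    (fun y => ?_) i j k y
  have h3 : localRep e L x y = Real.sqrt (B (A y) (A y)) := hB _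
  unfold energy
  rw [h3, Real.sq_sqrt (hpos _)]
  rfl

end Charts

end FinslerGeometry

theorem proposition4p2 {n : ℕ} {M : Type*} [TopologicalSpace M]
    [ChartedSpace (EuclideanSpace ℝ (Fin n)) M] [IsManifold (𝓡 n) ∞ M]
    (L : ∀ p : M, TangentSpace (𝓡 n) p → ℝ) (σ : M → ℝ)
    (β : ∀ p : M, TangentSpace (𝓡 n) p →L[ℝ] ℝ)
    (hL : IsFinsler L) (hσ : ContMDiff (𝓡 n) 𝓘(ℝ) ∞ σ) (hβ : IsSmoothOneForm β)
    (hLb : IsFinsler (betaConformal σ β L))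
    (e : OpenPartialHomeomorph M (EuclideanSpace ℝ (Fin n)))
    (he : e ∈ IsManifold.maximalAtlas (𝓡 n) ∞ M)
    (x : EuclideanSpace ℝ (Fin n)) (hx : x ∈ e.target)
    (y : EuclideanSpace ℝ (Fin n)) (hy : y ≠ 0)
    -- coordinate expressions of `L`, of the changed function, of `σ` and of the one-form
    (l lb : Vec n → Vec n → ℝ) (s : Vec n → ℝ) (b : Fin n → Vec n → ℝ)
    (hl : l = localRep e L) (hlb : lb = localRep e (betaConformal σ β L))
    (hs : s = fun x' => σ (e.symm x')) (hb : b = oneFormComp e β) :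
    (∀ i j : Fin n,
      -- both expressions that define `G_ij` through the difference tensor agree
      ∑ r, L2 l i r x y * diff0 l lb r j x y = tensorG l lb s b i j x y ∧
      -- the expression of `G_ij` free from the difference tensor
      tensorG l lb s b i j x y =
        Real.exp (-s x) * skewF l b i j x y
        + Real.exp (-s x) / l x y * (L1 l i x y * skewF0 l b j x y + L1 l j x y * skewF0 l b i x y)
        - 2 * Real.exp (-s x) * ∑ k, cartanUp l k i j x y * skewF0 l b k x y
        + 1 / (2 * l x y * lb x y)
            * (symE00 l b x y - 2 * l x y * Real.exp (-s x) * skewFβ0 l b x y) * angular l i j x y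
        + (1 / 2) * (l x y ^ 2 * ∑ r, L3 l i j r x y * sigUp l s r x y
            + l x y ^ 2 / lb x y * L2 l i j x y * sigβ l s b x y
            + (sig0 s x y * L2 l i j x y - muT l s i j x y))
        + l x y / lb x y * Real.exp (s x) * sig0 s x y * L2 l i j x y) ∧
    -- the Randers case
    ((∀ p, σ p = 0) → IsRiemannian L →
      (∀ i j : Fin n, tensorG l lb s b i j x y =
        skewF l b i j x y
        + 1 / l x y * (L1 l i x y * skewF0 l b j x y + L1 l j x y * skewF0 l b i x y)
        + 1 / (2 * l x y * lb x y)
            * (symE00 l b x y - 2 * l x y * skewFβ0 l b x y) * angular l i j x y) ∧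
      (∀ i : Fin n,
        ∑ r, L1 lb r x y * diff0 l lb r i x y = covectorG l lb s b i x y ∧
        covectorG l lb s b i x y = symE0 l b i x y - skewF0 l b i x y)) := by
  subst hl hlb hs hb
  have h := localBetaChange_of_isFinsler hL hσ hβ hLb he
  refine ⟨fun i j => ⟨h.sum_L2_mul_diff0 hx hy i j, h.tensorG_eq hx hy i j⟩, fun hσ0 hR => ?_⟩
  have hs : (fun x' => σ (e.symm x')) = fun _ => 0 := funext fun _ => hσ0 _
  have hsig : ∀ i, sig (fun _ => 0) i x = 0 := fun i => by simp [sig]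
  refine ⟨fun i j => ?_, fun i => ?_⟩
  · rw [h.tensorG_eq hx hy]
    simp [sigUp, sigβ, sig0, muT, hsig, hσ0, hR.cartanUp_eq_zero]
  · rw [h.sum_L1_mul_diff0 hx hy, h.covectorG_eq hx hy, hs, hsig]
    simp
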